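/- Let $H$ be a complex Hilbert space (infinite-dimensional separable spaces being the main case; no restriction on the dimension is needed), with inner product $(\cdot,\cdot)$ linear in the first variable. A contraction $T\in\mathbb B(H)$, $\|T\|\le 1$, is *completely non-unitary* (c.n.u.) if the only closed subspace $\mathcal K\subseteq H$ with $T\mathcal K\subseteq\mathcal K$ and $T|_{\mathcal K}$ unitary on $\mathcal K$ is $\mathcal K=0$. A *strong symplectic structure* on a Hilbert space $E$ is a continuous sesquilinear form $[\cdot,\cdot]$ (linear in the first, conjugate-linear in the second variable) with $[y,x]=-\overline{[x,y]}$, non-degenerate, and such that every continuous linear functional on $E$ has the form $[\cdot,x]$. For a subspace $L$ put $L^{\perp_s}=\{x : [x,y]=0\ \forall y\in L\}$. A closed subspace $L$ is *maximally positive-definite* if $-i[x,x]>0$ for all $0\ne x\in L$ and $L$ is not properly contained in another subspace with this property; it is *maximally completely positive-definite* if moreover $-i[x,x]\ge c\|x\|^2$ on $L$ for some $c>0$. The set $W_+(E)$ of maximally completely positive-definite subspaces is a complex Banach manifold: for any $P\in W_+(E)$ a global chart sends $\{x+Bx : x\in P\}$ to $B\in\mathbb B(P,P^{\perp_s})$.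 A *marked Nevanlinna disc* in $W_+(E)$ is a pair $(N,L)$ of a holomorphic map $N:\mathbb D\to W_+(E)$ on the open unit disc and a maximally positive-definite subspace $L\subseteq E$. Marked Nevanlinna discs $(N_1,L_1)$ in $W_+(E_1)$ and $(N_2,L_2)$ in $W_+(E_2)$ are *congruent* if there is a topological linear isomorphism $\Phi:E_1\to E_2$ with $[\Phi x,\Phi y]_2=[x,y]_1$ for all $x,y$, $\Phi(N_1(\lambda))=N_2(\lambda)$ for all $\lambda\in\mathbb D$, and $\Phi(L_1)=L_2$. For a contraction $T$ on $H$ let $\mathbb K=\ker(\mathrm{Id}-T^*T)$, equip $H\oplus H$ with $[(x_1,x_2),(y_1,y_2)]=i(x_1,y_1)-i(x_2,y_2)$, and put $A_T=\{(x,Tx) : x\in\mathbb K\}$. Then $A_T\subseteq A_T^{\perp_s}$, and $\mathcal B_T=A_T^{\perp_s}/A_T$ carries the quotient Hilbert space structure and the quotient form. For $\lambda\in\mathbb D$ let $W_T(\lambda)\subseteq\mathcal B_T$ be the image of $\{(x,\lambda x) : x\in H\}\cap A_T^{\perp_s}$ (the Weyl curve of $T$), and let $L_T\subseteq\mathcal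 B_T$ be the image of $\{(x,Tx) : x\in\mathbb K^\perp\}\subseteq A_T^{\perp_s}$, the subspace determined by the non-unitary part $T|_{\mathbb K^\perp}$. **Proposition.** Let $T_1$ and $T_2$ be c.n.u. contractions on Hilbert spaces $H_1$ and $H_2$. Then, for $j=1,2$, the quotient form on $\mathcal B_{T_j}$ is a strong symplectic structure and $(W_{T_j},L_{T_j})$ is a marked Nevanlinna disc in $W_+(\mathcal B_{T_j})$. Moreover, $T_1$ and $T_2$ are unitarily equivalent (there is a unitary $U:H_1\to H_2$ with $UT_1=T_2U$) if and only if the marked Nevanlinna discs $(W_{T_1},L_{T_1})$ and $(W_{T_2},L_{T_2})$ are congruent. -/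

import Mathlib

open Complex ComplexConjugate

noncomputable section

namespace NevanlinnaDisc

/-! ### Strong symplectic Hilbert spaces -/

section Symplectic

variable {E : Type*} [NormedAddCommGroup E] [InnerProductSpace ℂ E]

/-- A strong symplectic structure `[x, y] = ω x y` on a Hilbert space: linear in `x` and
conjugate-linear in `y` (built into the type of `ω`), jointly continuous, skew-Hermitian,
non-degenerate, and such that every continuous linear functional is of the form `[·, x]`. -/
structure IsStrongSymplectic [CompleteSpace E] (ω : E →ₗ[ℂ] E →ₗ⋆[ℂ] ℂ) : Prop where
  continuous : Continuous fun p : E × E => ω p.1 p.2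
  skew : ∀ x y, ω y x = -conj (ω x y)
  nondegenerate : ∀ x, (∀ y, ω x y = 0) → x = 0
  surjective : ∀ f : E →L[ℂ] ℂ, ∃ x, ∀ y, f y = ω y x

/-- The symplectic orthogonal complement `{x | [x, y] = 0 for all y ∈ L}`. -/
def symplOrth (ω : E →ₗ[ℂ] E →ₗ⋆[ℂ] ℂ) (L : Submodule ℂ E) : Submodule ℂ E where
  carrier := {x | ∀ y ∈ L, ω x y = 0}
  add_mem' := by
    intro a b ha hb y hy
    simp [ha y hy, hb y hy]
  zero_mem' := by
    intro y _
    simp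
  smul_mem' := by
    intro c x hx y hy
    simp [hx y hy]

/-- `-i[x, x] > 0` for all nonzero `x ∈ L` (the number `-i[x, x]` is real). -/
def IsPosDef (ω : E →ₗ[ℂ] E →ₗ⋆[ℂ] ℂ) (L : Submodule ℂ E) : Prop :=
  ∀ x ∈ L, x ≠ 0 → 0 < (-I * ω x x).re

/-- Maximal positive-definite (closed) subspaces. -/
structure IsMaxPosDef (ω : E →ₗ[ℂ] E →ₗ⋆[ℂ] ℂ) (L : Submodule ℂ E) : Prop where
  isClosed : IsClosed (L : Set E)
  posDef : IsPosDef ω L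
  maximal : ∀ M : Submodule ℂ E, IsPosDef ω M → L ≤ M → M = L

/-- Maximal completely positive-definite subspaces, i.e. the points of `W₊(E)`. -/
structure IsMaxComplPosDef (ω : E →ₗ[ℂ] E →ₗ⋆[ℂ] ℂ) (L : Submodule ℂ E) : Prop
    extends IsMaxPosDef ω L where
  complete : ∃ c : ℝ, 0 < c ∧ ∀ x ∈ L, c * ‖x‖ ^ 2 ≤ (-I * ω x x).re

/-- Holomorphy on the open unit disc of a map into `W₊(E)`. A polarization `P ∈ W₊(E)` gives a
global chart of `W₊(E)`, in which a point is the graph `{x + B x | x ∈ P}` of a bounded operator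
`B` from `P` to its symplectic complement; charts given by different polarizations are
holomorphically compatible. -/
def IsHolomorphicOnDisc (ω : E →ₗ[ℂ] E →ₗ⋆[ℂ] ℂ) (N : ℂ → Submodule ℂ E) : Prop :=
  ∃ P : Submodule ℂ E, IsMaxComplPosDef ω P ∧
    ∃ B : ℂ → (P →L[ℂ] symplOrth ω P),
      DifferentiableOn ℂ B (Metric.ball 0 1) ∧
      ∀ z ∈ Metric.ball (0 : ℂ) 1, ∀ v : E, v ∈ N z ↔ ∃ x : P, v = (x : E) + (B z x : E)

end Symplectic

/-- The data of a marked disc: a sesquilinear form, a curve of subspaces (only its values on the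
open unit disc matter), and a marked subspace. -/
structure MarkedDisc (E : Type*) [NormedAddCommGroup E] [InnerProductSpace ℂ E] where
  form : E →ₗ[ℂ] E →ₗ⋆[ℂ] ℂ
  curve : ℂ → Submodule ℂ E
  mark : Submodule ℂ E

/-- `D` is a marked Nevanlinna disc: the form is a strong symplectic structure, the curve is a
holomorphic map from the open unit disc to `W₊(E)`, and the marked subspace is maximally
positive-definite. -/
structure MarkedDisc.IsNevanlinna {E : Type*} [NormedAddCommGroup E] [InnerProductSpace ℂ E]
    [CompleteSpace E] (D : MarkedDisc E) : Prop where
  strong : IsStrongSymplectic D.form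
  mem : ∀ z ∈ Metric.ball (0 : ℂ) 1, IsMaxComplPosDef D.form (D.curve z)
  holomorphic : IsHolomorphicOnDisc D.form D.curve
  mark : IsMaxPosDef D.form D.mark

/-- Congruence: some symplectic isomorphism (a linear homeomorphism preserving the forms, not
necessarily isometric) carries one curve to the other, pointwise on the open unit disc, and one
marked subspace to the other. -/
def MarkedDisc.Congruent {E F : Type*} [NormedAddCommGroup E] [InnerProductSpace ℂ E]
    [NormedAddCommGroup F] [InnerProductSpace ℂ F] (D : MarkedDisc E) (D' : MarkedDisc F) : Prop :=
  ∃ Φ : E ≃L[ℂ] F,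
    (∀ x y, D'.form (Φ x) (Φ y) = D.form x y) ∧
    (∀ z ∈ Metric.ball (0 : ℂ) 1, (D.curve z).map (Φ : E →ₗ[ℂ] F) = D'.curve z) ∧
    D.mark.map (Φ : E →ₗ[ℂ] F) = D'.mark

/-! ### The quotient `L^⊥ˢ / L` -/

section Quotient

variable {E : Type*} [NormedAddCommGroup E] [InnerProductSpace ℂ E]

/-- The quotient of `L^⊥ˢ` by (its intersection with) `L`; used for closed `L ⊆ L^⊥ˢ`, with the
quotient Hilbert space structure. -/
abbrev SymplQuot (ω : E →ₗ[ℂ] E →ₗ⋆[ℂ] ℂ) (L : Submodule ℂ E) : Type _ :=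
  (symplOrth ω L) ⧸ (L.submoduleOf (symplOrth ω L))

/-- The image in `L^⊥ˢ / L` of `M ∩ L^⊥ˢ`. -/
def toQuot (ω : E →ₗ[ℂ] E →ₗ⋆[ℂ] ℂ) (L M : Submodule ℂ E) : Submodule ℂ (SymplQuot ω L) :=
  (M.submoduleOf (symplOrth ω L)).map (L.submoduleOf (symplOrth ω L)).mkQ

/-- The quotient form `[[x], [y]] = [x, y]` on `L^⊥ˢ / L`. -/
def quotForm (ω : E →ₗ[ℂ] E →ₗ⋆[ℂ] ℂ) (hω : ∀ x y, ω y x = -conj (ω x y))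
    (L : Submodule ℂ E) : SymplQuot ω L →ₗ[ℂ] SymplQuot ω L →ₗ⋆[ℂ] ℂ :=
  (L.submoduleOf (symplOrth ω L)).liftQ
    { toFun := fun x => (L.submoduleOf (symplOrth ω L)).liftQ
        ((ω (x : E)).comp (symplOrth ω L).subtype)
        (fun y hy => x.2 _ hy)
      map_add' := by
        intro x y
        ext z
        change ω ((x : E) + y) z = ω x z + ω y z
        simp
      map_smul' := by
        intro c x
        ext z
        change ω (c • (x : E)) z = c • ω x z
        simp }
    (by
      intro x hx
      rw [LinearMap.mem_ker]
      ext z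
      have h : ω (z : E) (x : E) = 0 := z.2 _ hx
      change ω (x : E) z = 0
      simp [hω (z : E) (x : E), h])

theorem quotForm_mk (ω : E →ₗ[ℂ] E →ₗ⋆[ℂ] ℂ) (hω : ∀ x y, ω y x = -conj (ω x y))
    (L : Submodule ℂ E) (x y : symplOrth ω L) :
    quotForm ω hω L (Submodule.Quotient.mk x) (Submodule.Quotient.mk y) = ω (x : E) (y : E) :=
  rfl

end Quotient

/-! ### Contractions -/

section Contraction

variable {H : Type*} [NormedAddCommGroup H] [InnerProductSpace ℂ H]

/-- `T` is completely non-unitary: the only closed invariant subspace on which `T` restricts to a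
unitary operator (an isometry of the subspace onto itself) is `0`. -/
def IsCNU (T : H →L[ℂ] H) : Prop :=
  ∀ K : Submodule ℂ H, IsClosed (K : Set H) → K.map (T : H →ₗ[ℂ] H) = K →
    (∀ x ∈ K, ‖T x‖ = ‖x‖) → K = ⊥

/-- Unitary equivalence of bounded operators. -/
def UnitarilyEquivalent {H' : Type*} [NormedAddCommGroup H'] [InnerProductSpace ℂ H']
    (T : H →L[ℂ] H) (T' : H' →L[ℂ] H') : Prop :=
  ∃ U : H ≃ₗᵢ[ℂ] H', ∀ x, U (T x) = T' (U x)

variable (H) in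
/-- The standard form `[(x₁,x₂),(y₁,y₂)] = i(x₁,y₁) - i(x₂,y₂)` on `H ⊕ H`, where
`(x, y) = inner ℂ y x` is linear in `x`. -/
def stdForm : WithLp 2 (H × H) →ₗ[ℂ] WithLp 2 (H × H) →ₗ⋆[ℂ] ℂ :=
  LinearMap.mk₂'ₛₗ (RingHom.id ℂ) (starRingEnd ℂ)
    (fun x y => I * inner ℂ y.fst x.fst - I * inner ℂ y.snd x.snd)
    (by intros; simp; ring)
    (by intros; simp; ring)
    (by intros; simp; ring)
    (by intros; simp; ring)

theorem stdForm_apply (x y : WithLp 2 (H × H)) :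
    stdForm H x y = I * inner ℂ y.fst x.fst - I * inner ℂ y.snd x.snd :=
  rfl

theorem stdForm_skew (x y : WithLp 2 (H × H)) : stdForm H y x = -conj (stdForm H x y) := by
  simp [stdForm_apply]
  ring

/-- The map `x ↦ (x, S x)` from `H` to `H ⊕ H`. -/
def graphMap (S : H →L[ℂ] H) : H →L[ℂ] WithLp 2 (H × H) :=
  (WithLp.prodContinuousLinearEquiv 2 ℂ H H).symm.toContinuousLinearMap ∘L
    (ContinuousLinearMap.id ℂ H).prod S

theorem graphMap_apply (S : H →L[ℂ] H) (x : H) : graphMap S x = WithLp.toLp 2 (x, S x) :=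
  rfl

/-- The universal Weyl curve `W_z = {(x, z x) | x ∈ H}`. -/
def universalWeyl (H : Type*) [NormedAddCommGroup H] [InnerProductSpace ℂ H] (z : ℂ) :
    Submodule ℂ (WithLp 2 (H × H)) :=
  (⊤ : Submodule ℂ H).map (graphMap (z • ContinuousLinearMap.id ℂ H) : H →ₗ[ℂ] WithLp 2 (H × H))

theorem isClosed_symplOrth_stdForm (L : Submodule ℂ (WithLp 2 (H × H))) :
    IsClosed (symplOrth (stdForm H) L : Set (WithLp 2 (H × H))) := by
  have h : (symplOrth (stdForm H) L : Set (WithLp 2 (H × H))) =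
      ⋂ y ∈ L, {x | stdForm H x y = 0} := by
    ext x
    simp [symplOrth]
  rw [h]
  refine isClosed_biInter fun y _ => isClosed_eq ?_ continuous_const
  simp only [stdForm_apply]
  fun_prop

variable [CompleteSpace H]

/-- `K = ker(Id - T*T)`. -/
def unitaryDomain (T : H →L[ℂ] H) : Submodule ℂ H :=
  LinearMap.ker (ContinuousLinearMap.id ℂ H - ContinuousLinearMap.adjoint T ∘L T : H →ₗ[ℂ] H)

/-- `A_T = {(x, T x) | x ∈ K}`, the graph of the unitary map part of `T`. -/
def unitaryGraph (T : H →L[ℂ] H) : Submodule ℂ (WithLp 2 (H × H)) :=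
  (unitaryDomain T).map (graphMap T : H →ₗ[ℂ] WithLp 2 (H × H))

/-- `{(x, T x) | x ∈ K^⊥}`, the graph of the non-unitary map part of `T`. -/
def nonUnitaryGraph (T : H →L[ℂ] H) : Submodule ℂ (WithLp 2 (H × H)) :=
  (unitaryDomain T)ᗮ.map (graphMap T : H →ₗ[ℂ] WithLp 2 (H × H))

theorem isClosed_unitaryDomain (T : H →L[ℂ] H) : IsClosed (unitaryDomain T : Set H) :=
  (ContinuousLinearMap.id ℂ H - ContinuousLinearMap.adjoint T ∘L T).isClosed_ker

theorem isClosed_unitaryGraph (T : H →L[ℂ] H) :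
    IsClosed (unitaryGraph T : Set (WithLp 2 (H × H))) := by
  have h : (unitaryGraph T : Set (WithLp 2 (H × H))) =
      {p | p.fst ∈ unitaryDomain T} ∩ {p | p.snd = T p.fst} := by
    ext p
    constructor
    · rintro ⟨x, hx, rfl⟩
      exact ⟨hx, rfl⟩
    · rintro ⟨h1, h2⟩
      refine ⟨p.fst, h1, ?_⟩
      change WithLp.toLp 2 (p.fst, T p.fst) = p
      rw [← (show p.snd = T p.fst from h2)]
      rfl
  rw [h]
  refine IsClosed.inter ?_ (isClosed_eq (by fun_prop) (by fun_prop))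
  exact (isClosed_unitaryDomain T).preimage (by fun_prop)

instance (T : H →L[ℂ] H) : CompleteSpace (symplOrth (stdForm H) (unitaryGraph T)) :=
  (isClosed_symplOrth_stdForm _).completeSpace_coe

instance isClosed_submoduleOf (T : H →L[ℂ] H) :
    IsClosed (((unitaryGraph T).submoduleOf (symplOrth (stdForm H) (unitaryGraph T)) :
      Submodule ℂ (symplOrth (stdForm H) (unitaryGraph T))) :
      Set (symplOrth (stdForm H) (unitaryGraph T))) :=
  (isClosed_unitaryGraph T).preimage continuous_subtype_val

instance (T : H →L[ℂ] H) :
    CompleteSpace ((unitaryGraph T).submoduleOf (symplOrth (stdForm H) (unitaryGraph T))) :=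
  (isClosed_submoduleOf T).completeSpace_coe

/-- `B_T = A_T^⊥ˢ / A_T`, with the quotient Hilbert space structure. -/
abbrev BoundarySpace (T : H →L[ℂ] H) : Type _ :=
  SymplQuot (stdForm H) (unitaryGraph T)

/-- The marked disc of `T` in `B_T`: the quotient form, the Weyl curve (the image of
`W_z ∩ A_T^⊥ˢ`), and the image of the graph of the non-unitary map part of `T` (which is
contained in `A_T^⊥ˢ`). -/
def markedDisc (T : H →L[ℂ] H) : MarkedDisc (BoundarySpace T) where
  form := quotForm (stdForm H) stdForm_skew (unitaryGraph T)
  curve z := toQuot (stdForm H) (unitaryGraph T) (universalWeyl H z)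
  mark := toQuot (stdForm H) (unitaryGraph T) (nonUnitaryGraph T)

end Contraction

end NevanlinnaDisc

end

/-! Write `J = P_K T*` and `J' = T P_K`, the adjoint of the isometric part and the isometric part of
`T`. They are mutually adjoint partial isometries with `ker J' = K^⊥` and `ker J = (T K)^⊥`. Every
class in the boundary space has exactly one representative in `K^⊥ ⊕ (T K)^⊥`, where the form is
`i(·,·) - i(·,·)`; see `isSplitting_boundaryEquiv`. In these coordinates the Weyl curve is the graph
of `θ(z) = z q (1 - z J)⁻¹` on `K^⊥`, with `q` the projection onto `ker J` (`mem_curve_iff`), and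
the marked subspace is the graph of `T` on `K^⊥` (`mem_mark_iff`). Both are graphs of strict
contractions, uniformly so for each `θ(z)`, which gives the Nevanlinna property.

A unitary equivalence restricts to the defect spaces and induces a congruence. Conversely, since
`θ(0) = 0`, a congruence preserves the positive summand, hence also the negative one, and is a sum
of unitaries `V ⊕ W` intertwining the functions `θ`. The Taylor coefficients of `θ` are the moments
`q Jⁿ` on `ker J'`, and these determine all inner products among the vectors `Jⁿ x` and `J'ⁿ y` with
`x ∈ ker J'`, `y ∈ ker J`. For c.n.u. `T` these vectors span a dense subspace
(`IsCNU.dense_orbitVectors`), so `V` and `W` extend to a unitary `U` intertwining the partial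
isometries. The marked subspaces make `U` intertwine the operators on `K^⊥` as well, hence
everywhere. -/

noncomputable section

namespace NevanlinnaDisc

/-! ### Symplectic spaces split as a positive and a negative Hilbert space -/

section Split

variable {E X Y : Type*} [NormedAddCommGroup E] [InnerProductSpace ℂ E]
  [NormedAddCommGroup X] [InnerProductSpace ℂ X] [NormedAddCommGroup Y] [InnerProductSpace ℂ Y]

/-- The isomorphism `e : E ≃ X × Y` carries `ω` to the form `i(x₁, y₁) - i(x₂, y₂)`. -/
def IsSplitting (ω : E →ₗ[ℂ] E →ₗ⋆[ℂ] ℂ) (e : E ≃L[ℂ] X × Y) : Prop :=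
  ∀ v w, ω v w = I * inner ℂ (e w).1 (e v).1 - I * inner ℂ (e w).2 (e v).2

variable {ω : E →ₗ[ℂ] E →ₗ⋆[ℂ] ℂ} {e : E ≃L[ℂ] X × Y}

theorem IsSplitting.re_self (h : IsSplitting ω e) (v : E) :
    (-I * ω v v).re = ‖(e v).1‖ ^ 2 - ‖(e v).2‖ ^ 2 := by
  rw [h v v, inner_self_eq_norm_sq_to_K, inner_self_eq_norm_sq_to_K]
  have : -I * (I * ((‖(e v).1‖ : ℂ)) ^ 2 - I * ((‖(e v).2‖ : ℂ)) ^ 2) =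
      ((‖(e v).1‖ ^ 2 - ‖(e v).2‖ ^ 2 : ℝ) : ℂ) := by
    push_cast
    linear_combination (((‖(e v).2‖ : ℂ)) ^ 2 - ((‖(e v).1‖ : ℂ)) ^ 2) * I_mul_I
  exact (congrArg Complex.re this).trans (ofReal_re _)

theorem IsSplitting.isStrongSymplectic [CompleteSpace E] [CompleteSpace X] [CompleteSpace Y]
    (h : IsSplitting ω e) : IsStrongSymplectic ω where
  continuous := by
    simp only [h _ _]
    fun_prop
  skew x y := by
    rw [h x y, h y x]
    simp
    ring
  nondegenerate x hx := by
    -- Flipping the sign of the negative component turns the form into `i` times a positive-definite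
    -- one.
    have h0 := hx (e.symm ((e x).1, -(e x).2))
    rw [h, e.apply_symm_apply] at h0
    simp only [inner_neg_left, inner_self_eq_norm_sq_to_K] at h0
    have h1 : I * (((‖(e x).1‖ ^ 2 + ‖(e x).2‖ ^ 2 : ℝ) : ℂ)) = 0 := by
      rw [← h0]
      push_cast
      simp
      ring
    have h2 : ‖(e x).1‖ ^ 2 + ‖(e x).2‖ ^ 2 = 0 := by
      exact_mod_cast (mul_eq_zero.1 h1).resolve_left I_ne_zero
    have h3 : ‖(e x).1‖ = 0 := by nlinarith [sq_nonneg ‖(e x).1‖, sq_nonneg ‖(e x).2‖]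
    have h4 : ‖(e x).2‖ = 0 := by nlinarith [sq_nonneg ‖(e x).1‖, sq_nonneg ‖(e x).2‖]
    exact e.map_eq_zero_iff.1 (Prod.ext (norm_eq_zero.1 h3) (norm_eq_zero.1 h4))
  surjective f := by
    let g : X × Y →L[ℂ] ℂ := f ∘L (e.symm : X × Y →L[ℂ] E)
    let a := (InnerProductSpace.toDual ℂ X).symm (g ∘L ContinuousLinearMap.inl ℂ X Y)
    let b := (InnerProductSpace.toDual ℂ Y).symm (g ∘L ContinuousLinearMap.inr ℂ X Y)
    -- `a` and `b` are the Riesz vectors of the two restrictions; the factors `I` and `-I`,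
    -- conjugated in the second slot, cancel the coefficients of the form.
    refine ⟨e.symm (I • a, -I • b), fun y => ?_⟩
    rw [h, e.apply_symm_apply]
    simp only [inner_smul_left, a, b, InnerProductSpace.toDual_symm_apply]
    have hy : f y = g ((e y).1, 0) + g (0, (e y).2) := by
      rw [← map_add]
      simp [g]
    rw [hy]
    simp only [ContinuousLinearMap.comp_apply, ContinuousLinearMap.inl_apply,
      ContinuousLinearMap.inr_apply, map_neg, conj_I]
    linear_combination (g ((e y).1, 0) + g (0, (e y).2)) * I_mul_I

/-- On the graph the form is `‖x‖² - ‖Θ x‖²`. For maximality, a vector of a larger subspace differs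
from the graph point over the same `x` by a vector of `0 ⊕ Y`, where the form is nonpositive. -/
theorem IsSplitting.isMaxPosDef_of_graph (h : IsSplitting ω e) {L : Submodule ℂ E} (Θ : X →L[ℂ] Y)
    (hL : ∀ v, v ∈ L ↔ (e v).2 = Θ (e v).1) (hΘ : ∀ x, x ≠ 0 → ‖Θ x‖ < ‖x‖) :
    IsMaxPosDef ω L where
  isClosed := by
    have : (L : Set E) = {v | (e v).2 = Θ (e v).1} := Set.ext hL
    rw [this]
    exact isClosed_eq (by fun_prop) (by fun_prop)
  posDef v hv hv0 := by
    rw [h.re_self, (hL v).1 hv]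
    have hx : (e v).1 ≠ 0 := fun h0 => hv0 (e.map_eq_zero_iff.1 (Prod.ext h0 (by
      rw [(hL v).1 hv, h0, map_zero]; rfl)))
    have := hΘ _ hx
    have := norm_nonneg (Θ (e v).1)
    nlinarith
  maximal M hM hLM := by
    refine le_antisymm (fun v hv => ?_) hLM
    let w := e.symm ((e v).1, Θ (e v).1)
    have hw : w ∈ L := by rw [hL]; simp [w]
    by_contra hvL
    have hne : v - w ≠ 0 := fun h0 => hvL (by rwa [sub_eq_zero.1 h0])
    have hpos := hM _ (M.sub_mem hv (hLM hw)) hne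
    rw [h.re_self] at hpos
    have : (e (v - w)).1 = 0 := by simp [w]
    rw [this, norm_zero] at hpos
    nlinarith [sq_nonneg ‖(e (v - w)).2‖]

theorem IsSplitting.isMaxComplPosDef_of_graph (h : IsSplitting ω e) {L : Submodule ℂ E}
    (Θ : X →L[ℂ] Y) (hL : ∀ v, v ∈ L ↔ (e v).2 = Θ (e v).1) {c : ℝ} (hc : 0 < c)
    (hΘ : ∀ x, ‖Θ x‖ ^ 2 + c * ‖x‖ ^ 2 ≤ ‖x‖ ^ 2) : IsMaxComplPosDef ω L where
  toIsMaxPosDef := h.isMaxPosDef_of_graph Θ hL fun x hx => by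
    have h0 : 0 < ‖x‖ := norm_pos_iff.2 hx
    have := hΘ x
    have : 0 < c * ‖x‖ ^ 2 := by positivity
    exact lt_of_pow_lt_pow_left₀ 2 h0.le (by linarith)
  complete := by
    let C := ‖(e.symm : X × Y →L[ℂ] E)‖
    -- On the graph `‖v‖ ≤ C ‖x‖`, because `‖Θ x‖ ≤ ‖x‖` and the product carries the sup norm. The
    -- `+ 1` keeps the denominator positive when `C = 0`.
    refine ⟨c / (C ^ 2 + 1), by positivity, fun v hv => ?_⟩
    rw [h.re_self, (hL v).1 hv]
    have h1 := hΘ (e v).1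
    have h3 : ‖Θ (e v).1‖ ≤ ‖(e v).1‖ := by
      refine le_of_sq_le_sq ?_ (norm_nonneg _)
      have : 0 ≤ c * ‖(e v).1‖ ^ 2 := by positivity
      linarith
    have h2 : ‖v‖ ≤ C * ‖(e v).1‖ := by
      calc ‖v‖ = ‖(e.symm : X × Y →L[ℂ] E) (e v)‖ := by simp
        _ ≤ C * ‖e v‖ := ContinuousLinearMap.le_opNorm _ _
        _ = C * ‖(e v).1‖ := by
          rw [Prod.norm_def, (hL v).1 hv, max_eq_left h3]
    have h4 : ‖v‖ ^ 2 ≤ C ^ 2 * ‖(e v).1‖ ^ 2 := by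
      rw [← mul_pow]
      exact pow_le_pow_left₀ (norm_nonneg _) h2 2
    have h5 : c / (C ^ 2 + 1) * ‖v‖ ^ 2 ≤ c * ‖(e v).1‖ ^ 2 := by
      rw [div_mul_eq_mul_div, div_le_iff₀ (by positivity)]
      nlinarith [mul_le_mul_of_nonneg_left h4 hc.le, mul_nonneg hc.le (sq_nonneg ‖(e v).1‖)]
    linarith

theorem IsSplitting.isHolomorphicOnDisc_of_graph (h : IsSplitting ω e) {N : ℂ → Submodule ℂ E}
    (Θ : ℂ → X →L[ℂ] Y) (hΘ : DifferentiableOn ℂ Θ (Metric.ball 0 1))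
    (hN : ∀ z ∈ Metric.ball (0 : ℂ) 1, ∀ v, v ∈ N z ↔ (e v).2 = Θ z (e v).1) :
    IsHolomorphicOnDisc ω N := by
  -- The chart is taken at `P = X ⊕ 0`. Its symplectic complement contains `0 ⊕ Y`, so `Θ z` itself
  -- becomes the chart coordinate.
  let P : Submodule ℂ E := (ContinuousLinearMap.snd ℂ X Y ∘L (e : E →L[ℂ] X × Y)).ker
  have hP : ∀ v, v ∈ P ↔ (e v).2 = 0 := fun v => Iff.rfl
  let fX : P →L[ℂ] X := ContinuousLinearMap.fst ℂ X Y ∘L (e : E →L[ℂ] X × Y) ∘L P.subtypeL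
  let gY : Y →L[ℂ] symplOrth ω P :=
    ((e.symm : X × Y →L[ℂ] E) ∘L ContinuousLinearMap.inr ℂ X Y).codRestrict (symplOrth ω P) (by
      intro y v hv
      rw [h]
      simp [(hP v).1 hv])
  have hg : ∀ y, ((gY y : symplOrth ω P) : E) = e.symm (0, y) := fun y => rfl
  refine ⟨P, h.isMaxComplPosDef_of_graph 0 (fun v => by simp [hP]) one_pos (by simp),
    fun z => gY ∘L Θ z ∘L fX, ?_, fun z hz v => ?_⟩
  · exact (differentiableOn_const _).clm_comp (hΘ.clm_comp (differentiableOn_const _))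
  · rw [hN z hz]
    constructor
    · intro hv
      refine ⟨⟨e.symm ((e v).1, 0), by simp [hP]⟩, ?_⟩
      apply e.injective
      simp [hg, fX, ← hv]
    · rintro ⟨x, rfl⟩
      have := (hP x).1 x.2
      simp [hg, fX, this]

end Split

/-! ### Partial isometries and their moments -/

section Gram

variable {H₁ H₂ : Type*}
  [NormedAddCommGroup H₁] [InnerProductSpace ℂ H₁]
  [NormedAddCommGroup H₂] [InnerProductSpace ℂ H₂]

theorem denseRange_linearCombination {ι : Type*} {a : ι → H₁}
    (ha : (Submodule.span ℂ (Set.range a)).topologicalClosure = ⊤) :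
    DenseRange (Finsupp.linearCombination ℂ a) := by
  rw [DenseRange, ← LinearMap.coe_range, Finsupp.range_linearCombination]
  exact Submodule.dense_iff_topologicalClosure_eq_top.2 ha

/-- Two families with dense spans and the same Gram matrix are unitarily equivalent. -/
theorem exists_linearIsometryEquiv_of_inner_eq [CompleteSpace H₁] [CompleteSpace H₂]
    {ι : Type*} {a : ι → H₁} {b : ι → H₂}
    (hab : ∀ i j, inner ℂ (b i) (b j) = inner ℂ (a i) (a j))
    (ha : (Submodule.span ℂ (Set.range a)).topologicalClosure = ⊤)
    (hb : (Submodule.span ℂ (Set.range b)).topologicalClosure = ⊤) :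
    ∃ U : H₁ ≃ₗᵢ[ℂ] H₂, ∀ i, U (a i) = b i := by
  -- Equal Gram matrices give equal norms to the two linear combinations with the same coefficients,
  -- so matching them is isometric and extends by density.
  have hnorm : ∀ c : ι →₀ ℂ, ‖Finsupp.linearCombination ℂ b (LinearEquiv.refl ℂ (ι →₀ ℂ) c)‖ =
      ‖Finsupp.linearCombination ℂ a c‖ := by
    intro c
    have : inner ℂ (Finsupp.linearCombination ℂ b c) (Finsupp.linearCombination ℂ b c) =
        inner ℂ (Finsupp.linearCombination ℂ a c) (Finsupp.linearCombination ℂ a c) := by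
      simp only [Finsupp.linearCombination_apply, Finsupp.sum_inner, Finsupp.inner_sum,
        inner_smul_left, inner_smul_right, hab]
    rw [LinearEquiv.refl_apply, @norm_eq_sqrt_re_inner ℂ, this, ← @norm_eq_sqrt_re_inner ℂ]
  refine ⟨(LinearEquiv.refl ℂ (ι →₀ ℂ)).extendOfIsometry _ _
    (denseRange_linearCombination ha) (denseRange_linearCombination hb) hnorm, fun i => ?_⟩
  have := LinearEquiv.extendOfIsometry_eq (LinearEquiv.refl ℂ (ι →₀ ℂ)) _ _
    (denseRange_linearCombination ha) (denseRange_linearCombination hb) hnorm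
    (Finsupp.single i 1)
  simpa using this

end Gram

section PartialIsometry

variable {H : Type*} [NormedAddCommGroup H] [InnerProductSpace ℂ H]

/-- `J` and `J'` are mutually adjoint partial isometries. -/
structure IsPartialIsometryPair (J J' : H →L[ℂ] H) : Prop where
  adj : ∀ x y, inner ℂ (J x) y = inner ℂ x (J' y)
  left : ∀ x, J (J' (J x)) = J x
  right : ∀ x, J' (J (J' x)) = J' x

variable {J J' : H →L[ℂ] H}

theorem IsPartialIsometryPair.symm (h : IsPartialIsometryPair J J') :
    IsPartialIsometryPair J' J where
  adj x y := by rw [← inner_conj_symm, ← h.adj, inner_conj_symm]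
  left := h.right
  right := h.left

/-- `J J' J = J` puts `x - J' J x` in `ker J`, and the range of `J'` is orthogonal to `ker J`. -/
theorem IsPartialIsometryPair.coe_proj [CompleteSpace H] (h : IsPartialIsometryPair J J') (x : H) :
    (J.ker.orthogonalProjectionOnto x : H) = x - J' (J x) := by
  rw [Submodule.coe_orthogonalProjectionOnto_apply]
  refine Submodule.eq_starProjection_of_mem_orthogonal ?_ ?_
  · simp [h.left]
  · rw [sub_sub_cancel, Submodule.mem_orthogonal]
    intro u hu
    rw [← h.adj, show J u = 0 from hu, inner_zero_left]

theorem IsPartialIsometryPair.adj_pow (h : IsPartialIsometryPair J J') (n : ℕ) (x y : H) :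
    inner ℂ ((J ^ n) x) y = inner ℂ x ((J' ^ n) y) := by
  induction n generalizing x y with
  | zero => simp
  | succ n ih =>
    rw [pow_succ', pow_succ, mul_apply_eq_comp, mul_apply_eq_comp, h.adj,
      ih]

theorem inner_proj_right {K : Submodule ℂ H} [K.HasOrthogonalProjection] (y : K) (x : H) :
    inner ℂ y (K.orthogonalProjectionOnto x) = inner ℂ (y : H) x := by
  rw [Submodule.inner_orthogonalProjectionOnto_eq_of_mem_left]

theorem inner_proj_left {K : Submodule ℂ H} [K.HasOrthogonalProjection] (y : K) (x : H) :
    inner ℂ (K.orthogonalProjectionOnto x) y = inner ℂ x (y : H) := by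
  rw [Submodule.inner_orthogonalProjectionOnto_eq_of_mem_right]

theorem IsPartialIsometryPair.inner_map_map [CompleteSpace H]
    (h : IsPartialIsometryPair J J') (x y : H) :
    inner ℂ (J x) (J y) = inner ℂ x y -
      inner ℂ (J.ker.orthogonalProjectionOnto x) (J.ker.orthogonalProjectionOnto y) := by
  rw [inner_proj_left, h.coe_proj, h.adj, inner_sub_right]
  ring

/-- The vectors `Jⁿ x` for `x ∈ ker J'` and `J'ⁿ y` for `y ∈ ker J`. -/
def orbitVectors (J J' : H →L[ℂ] H) : (ℕ × J'.ker) ⊕ (ℕ × J.ker) → H :=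
  Sum.elim (fun p => (J ^ p.1) p.2) (fun p => (J' ^ p.1) p.2)

end PartialIsometry

/-! ### From equal moments to an intertwining unitary -/

section Moments

variable {H₁ H₂ : Type*}
  [NormedAddCommGroup H₁] [InnerProductSpace ℂ H₁] [CompleteSpace H₁]
  [NormedAddCommGroup H₂] [InnerProductSpace ℂ H₂] [CompleteSpace H₂]
  {J₁ J₁' : H₁ →L[ℂ] H₁} {J₂ J₂' : H₂ →L[ℂ] H₂}

/-- The isometries `V` and `W` between the defect spaces carry the moments of `J₁` to those of
`J₂`. -/
def MomentsAgree (J₁ J₁' : H₁ →L[ℂ] H₁) (J₂ J₂' : H₂ →L[ℂ] H₂)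
    (V : J₁'.ker ≃ₗᵢ[ℂ] J₂'.ker) (W : J₁.ker ≃ₗᵢ[ℂ] J₂.ker) : Prop :=
  ∀ (n : ℕ) (x : J₁'.ker), W (J₁.ker.orthogonalProjectionOnto ((J₁ ^ n) x)) =
    J₂.ker.orthogonalProjectionOnto ((J₂ ^ n) (V x))

variable {V : J₁'.ker ≃ₗᵢ[ℂ] J₂'.ker} {W : J₁.ker ≃ₗᵢ[ℂ] J₂.ker}

/-- Moving `J'ᵐ` to the other side leaves `(Jⁿ⁺ᵐ x, y)` with `y ∈ ker J`, which sees only the moment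
of order `n + m`. -/
theorem MomentsAgree.inner_cross (hm : MomentsAgree J₁ J₁' J₂ J₂' V W)
    (h₁ : IsPartialIsometryPair J₁ J₁') (h₂ : IsPartialIsometryPair J₂ J₂') (n m : ℕ)
    (x : J₁'.ker) (y : J₁.ker) :
    inner ℂ ((J₂ ^ n) (V x)) ((J₂' ^ m) (W y)) =
      inner ℂ ((J₁ ^ n) (x : H₁)) ((J₁' ^ m) (y : H₁)) := by
  rw [← h₁.adj_pow, ← h₂.adj_pow, ← mul_apply_eq_comp, ← mul_apply_eq_comp,
    ← pow_add, ← pow_add, ← inner_proj_left, ← inner_proj_left, ← hm, W.inner_map_map]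

/-- The moments of `J'` are the adjoints of the moments of `J`. -/
theorem MomentsAgree.symm (hm : MomentsAgree J₁ J₁' J₂ J₂' V W)
    (h₁ : IsPartialIsometryPair J₁ J₁') (h₂ : IsPartialIsometryPair J₂ J₂') :
    MomentsAgree J₁' J₁ J₂' J₂ W V := by
  intro n y
  refine ext_inner_left ℂ fun v => ?_
  obtain ⟨x, rfl⟩ := V.surjective v
  rw [V.inner_map_map, inner_proj_right, inner_proj_right]
  simpa using (hm.inner_cross h₁ h₂ 0 n x y).symm

/-- Lowering both exponents by one changes the inner product by a product of moments
(`IsPartialIsometryPair.inner_map_map`). When exactly one exponent is zero the product vanishes,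
since `ker J'` is orthogonal to the range of `J`. -/
theorem MomentsAgree.inner_orbit (hm : MomentsAgree J₁ J₁' J₂ J₂' V W)
    (h₁ : IsPartialIsometryPair J₁ J₁') (h₂ : IsPartialIsometryPair J₂ J₂') (n m : ℕ)
    (x x' : J₁'.ker) :
    inner ℂ ((J₂ ^ n) (V x)) ((J₂ ^ m) (V x' : H₂)) =
      inner ℂ ((J₁ ^ n) (x : H₁)) ((J₁ ^ m) (x' : H₁)) := by
  induction n generalizing m with
  | zero =>
    cases m with
    | zero => exact V.inner_map_map x x'
    | succ m =>
      rw [pow_succ', pow_succ', mul_apply_eq_comp, mul_apply_eq_comp,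
        ← h₁.symm.adj, ← h₂.symm.adj]
      simp [show J₁' (x : H₁) = 0 from x.2, show J₂' (V x : H₂) = 0 from (V x).2]
  | succ n ih =>
    cases m with
    | zero =>
      rw [pow_succ', pow_succ', mul_apply_eq_comp, mul_apply_eq_comp,
        h₁.adj, h₂.adj]
      simp [show J₁' (x' : H₁) = 0 from x'.2, show J₂' (V x' : H₂) = 0 from (V x').2]
    | succ m =>
      simp only [pow_succ' _ n, pow_succ' _ m, mul_apply_eq_comp]
      rw [h₁.inner_map_map, h₂.inner_map_map, ih, ← hm, ← hm, W.inner_map_map]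

theorem MomentsAgree.exists_unitary (hm : MomentsAgree J₁ J₁' J₂ J₂' V W)
    (h₁ : IsPartialIsometryPair J₁ J₁') (h₂ : IsPartialIsometryPair J₂ J₂')
    (d₁ : (Submodule.span ℂ (Set.range (orbitVectors J₁ J₁'))).topologicalClosure = ⊤)
    (d₂ : (Submodule.span ℂ (Set.range (orbitVectors J₂ J₂'))).topologicalClosure = ⊤) :
    ∃ U : H₁ ≃ₗᵢ[ℂ] H₂, (∀ x : J₁'.ker, U x = V x) ∧ (∀ y : J₁.ker, U y = W y) ∧
      ∀ x, U (J₁ x) = J₂ (U x) := by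
  -- The second orbit family is reindexed along `V` and `W`, so that both families share an index
  -- set.
  let s : (ℕ × J₁'.ker) ⊕ (ℕ × J₁.ker) → (ℕ × J₂'.ker) ⊕ (ℕ × J₂.ker) :=
    Sum.map (Prod.map id V) (Prod.map id W)
  have hs : Function.Surjective s :=
    (Function.surjective_id.prodMap V.surjective).sumMap
      (Function.surjective_id.prodMap W.surjective)
  have d₂' : (Submodule.span ℂ (Set.range (orbitVectors J₂ J₂' ∘ s))).topologicalClosure = ⊤ := by
    rwa [hs.range_comp]
  have hm' := hm.symm h₁ h₂
  obtain ⟨U, hU⟩ := exists_linearIsometryEquiv_of_inner_eq (a := orbitVectors J₁ J₁')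
    (b := orbitVectors J₂ J₂' ∘ s) (by
      rintro (⟨n, x⟩ | ⟨n, y⟩) (⟨m, x'⟩ | ⟨m, y'⟩)
      · exact hm.inner_orbit h₁ h₂ n m x x'
      · exact hm.inner_cross h₁ h₂ n m x y'
      · exact hm'.inner_cross h₁.symm h₂.symm n m y x'
      · exact hm'.inner_orbit h₁.symm h₂.symm n m y y') d₁ d₂'
  have hX : ∀ (n : ℕ) (x : J₁'.ker), U ((J₁ ^ n) x) = (J₂ ^ n) (V x) :=
    fun n x => hU (Sum.inl (n, x))
  have hY : ∀ (n : ℕ) (y : J₁.ker), U ((J₁' ^ n) y) = (J₂' ^ n) (W y) :=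
    fun n y => hU (Sum.inr (n, y))
  have hX0 : ∀ x : J₁'.ker, U x = V x := hX 0
  refine ⟨U, hX0, hY 0, fun x => ?_⟩
  have hcl : IsClosed {x | U (J₁ x) = J₂ (U x)} := isClosed_eq (by fun_prop) (by fun_prop)
  refine (denseRange_linearCombination d₁).induction_on
    (p := fun x => U (J₁ x) = J₂ (U x)) x hcl fun c => ?_
  induction c using Finsupp.induction_linear with
  | zero => simp
  | add c d hc hd => simp only [map_add, hc, hd]
  | single i r =>
    simp only [Finsupp.linearCombination_single, map_smul]
    congr 1
    rcases i with ⟨n, x⟩ | ⟨n, y⟩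
    · have := hX (n + 1) x
      rw [pow_succ', pow_succ', mul_apply_eq_comp, mul_apply_eq_comp] at this
      change U (J₁ ((J₁ ^ n) x)) = J₂ (U ((J₁ ^ n) x))
      rw [this, hX]
    · change U (J₁ ((J₁' ^ n) y)) = J₂ (U ((J₁' ^ n) y))
      rw [hY]
      cases n with
      | zero => simp [show J₁ (y : H₁) = 0 from y.2, show J₂ (W y : H₂) = 0 from (W y).2]
      -- `J J'ⁿ⁺¹ y` is `J'ⁿ y` minus its projection onto `ker J'`, and that projection is a moment
      -- of `J'`, which `V` transports.
      | succ n =>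
        rw [pow_succ', pow_succ', mul_apply_eq_comp, mul_apply_eq_comp]
        have e₁ := h₁.symm.coe_proj ((J₁' ^ n) y)
        have e₂ := h₂.symm.coe_proj ((J₂' ^ n) (W y))
        rw [← hm' n y, ← hX0, e₁, map_sub, hY] at e₂
        exact sub_right_injective e₂

end Moments

/-! ### The characteristic function of a partial isometry -/

section CharFun

variable {H : Type*} [NormedAddCommGroup H] [InnerProductSpace ℂ H] [CompleteSpace H]
  {J J' : H →L[ℂ] H}

/-- The resolvent-type operator `(1 - z J)⁻¹`. -/
def resolv (J : H →L[ℂ] H) (z : ℂ) : H →L[ℂ] H := Ring.inverse (1 - z • J)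

theorem isUnit_one_sub_smul (hJ : ‖J‖ ≤ 1) {z : ℂ} (hz : z ∈ Metric.ball (0 : ℂ) 1) :
    IsUnit (1 - z • J) := by
  refine isUnit_one_sub_of_norm_lt_one ?_
  rw [norm_smul]
  have : ‖z‖ < 1 := by simpa using hz
  nlinarith [norm_nonneg z, norm_nonneg J]

theorem resolv_sub (hJ : ‖J‖ ≤ 1) {z : ℂ} (hz : z ∈ Metric.ball (0 : ℂ) 1) (x : H) :
    resolv J z x - z • J (resolv J z x) = x := by
  have := congrArg (fun A : H →L[ℂ] H => A x)
    (Ring.mul_inverse_cancel _ (isUnit_one_sub_smul hJ hz))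
  simpa [resolv] using this

theorem resolv_apply_eq (hJ : ‖J‖ ≤ 1) {z : ℂ} (hz : z ∈ Metric.ball (0 : ℂ) 1) {x w : H}
    (h : w - z • J w = x) : resolv J z x = w := by
  have := congrArg (fun A : H →L[ℂ] H => A w)
    (Ring.inverse_mul_cancel _ (isUnit_one_sub_smul hJ hz))
  rw [← h]
  simpa [resolv] using this

theorem differentiableOn_resolv (hJ : ‖J‖ ≤ 1) :
    DifferentiableOn ℂ (resolv J) (Metric.ball 0 1) := fun z hz =>
  ((differentiableAt_inverse (isUnit_one_sub_smul hJ hz)).comp z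
    ((differentiableAt_const _).sub (differentiableAt_id.smul_const J))).differentiableWithinAt

/-- The characteristic function `z q (1 - z J)⁻¹`, where `q` is the projection onto `ker J`. -/
def charFun (J J' : H →L[ℂ] H) (z : ℂ) : J'.ker →L[ℂ] J.ker :=
  J.ker.orthogonalProjectionOnto ∘L (z • resolv J z) ∘L J'.ker.subtypeL

theorem charFun_apply (z : ℂ) (x : J'.ker) :
    charFun J J' z x = z • J.ker.orthogonalProjectionOnto (resolv J z x) :=
  map_smul J.ker.orthogonalProjectionOnto z _

theorem differentiableOn_charFun (hJ : ‖J‖ ≤ 1) :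
    DifferentiableOn ℂ (charFun J J') (Metric.ball 0 1) :=
  (differentiableOn_const _).clm_comp
    ((differentiableOn_id.smul (differentiableOn_resolv hJ)).clm_comp (differentiableOn_const _))

/-- With `w = (1 - z J)⁻¹ x` one has `w = x + z J w` and `x ⊥ J w`. Pythagoras and `‖q w‖² = ‖w‖² -
‖J w‖²` give `‖x‖² - ‖θ(z) x‖² = (1 - ‖z‖²) ‖w‖²`, and `‖w‖ ≥ ‖x‖`. -/
theorem IsPartialIsometryPair.norm_charFun_sq (h : IsPartialIsometryPair J J') (hJ : ‖J‖ ≤ 1)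
    {z : ℂ} (hz : z ∈ Metric.ball (0 : ℂ) 1) (x : J'.ker) :
    ‖charFun J J' z x‖ ^ 2 + (1 - ‖z‖ ^ 2) * ‖x‖ ^ 2 ≤ ‖x‖ ^ 2 := by
  have hz1 : ‖z‖ < 1 := by simpa using hz
  set w := resolv J z x with hw
  have hx : w = x + z • J w := by rw [← resolv_sub hJ hz (x : H), ← hw]; abel
  have horth : inner ℂ (x : H) (z • J w) = 0 := by
    rw [inner_smul_right, ← h.symm.adj, show J' (x : H) = 0 from x.2, inner_zero_left, mul_zero]
  have h1 : ‖w‖ ^ 2 = ‖x‖ ^ 2 + ‖z‖ ^ 2 * ‖J w‖ ^ 2 := by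
    have := norm_add_sq_eq_norm_sq_add_norm_sq_of_inner_eq_zero (x : H) (z • J w) horth
    rw [← hx, norm_smul] at this
    rw [sq, this, Submodule.coe_norm]
    ring
  have h2 : ‖J.ker.orthogonalProjectionOnto w‖ ^ 2 = ‖w‖ ^ 2 - ‖J w‖ ^ 2 := by
    have := congrArg Complex.re (h.inner_map_map w w)
    simp only [inner_self_eq_norm_sq_to_K, Complex.sub_re] at this
    simp only [coe_algebraMap, ← ofReal_pow, ofReal_re] at this
    linarith
  have h3 : ‖charFun J J' z x‖ ^ 2 = ‖z‖ ^ 2 * (‖w‖ ^ 2 - ‖J w‖ ^ 2) := by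
    rw [charFun_apply, norm_smul, mul_pow, h2]
  have h4 : ‖x‖ ^ 2 ≤ ‖w‖ ^ 2 := by
    rw [h1]
    nlinarith [mul_nonneg (sq_nonneg ‖z‖) (sq_nonneg ‖J w‖)]
  rw [h3]
  have h5 : 0 ≤ 1 - ‖z‖ ^ 2 := by nlinarith [norm_nonneg z]
  nlinarith [mul_le_mul_of_nonneg_left h4 h5]

/-- `J J'` kills `x` and fixes the range of `J`; apply it to `w = x + z J w`. This is the condition
for `(w, z w)` to lie in `A_T^⊥ˢ`. -/
theorem IsPartialIsometryPair.proj_resolv (h : IsPartialIsometryPair J J') (hJ : ‖J‖ ≤ 1)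
    {z : ℂ} (hz : z ∈ Metric.ball (0 : ℂ) 1) (x : J'.ker) :
    J (J' (resolv J z x)) = z • J (resolv J z x) := by
  have h1 : resolv J z (x : H) = x + z • J (resolv J z x) := by
    nth_rewrite 2 [← resolv_sub hJ hz (x : H)]
    abel
  nth_rewrite 1 [h1]
  simp [show J' (x : H) = 0 from x.2, h.left]

end CharFun

/-! ### Recovering the moments from the characteristic function -/

section CharFunMoments

variable {H₁ H₂ : Type*}
  [NormedAddCommGroup H₁] [InnerProductSpace ℂ H₁] [CompleteSpace H₁]
  [NormedAddCommGroup H₂] [InnerProductSpace ℂ H₂] [CompleteSpace H₂]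
  {J₁ J₁' : H₁ →L[ℂ] H₁} {J₂ J₂' : H₂ →L[ℂ] H₂}
  {V : J₁'.ker ≃ₗᵢ[ℂ] J₂'.ker} {W : J₁.ker ≃ₗᵢ[ℂ] J₂.ker}

theorem proj_pow_resolv {H : Type*} [NormedAddCommGroup H] [InnerProductSpace ℂ H]
    [CompleteSpace H] {J : H →L[ℂ] H} (hJ : ‖J‖ ≤ 1) {z : ℂ} (hz : z ∈ Metric.ball (0 : ℂ) 1)
    (n : ℕ) (x : H) :
    J.ker.orthogonalProjectionOnto ((J ^ n) (resolv J z x)) =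
      J.ker.orthogonalProjectionOnto ((J ^ n) x) +
        z • J.ker.orthogonalProjectionOnto ((J ^ (n + 1)) (resolv J z x)) := by
  have h1 : resolv J z x = x + z • J (resolv J z x) := by
    nth_rewrite 2 [← resolv_sub hJ hz x]
    abel
  nth_rewrite 1 [h1]
  rw [pow_succ, mul_apply_eq_comp, map_add, map_add, map_smul, map_smul]

/-- The characteristic function determines the moments. -/
theorem momentsAgree_of_charFun (hJ₁ : ‖J₁‖ ≤ 1) (hJ₂ : ‖J₂‖ ≤ 1)
    (h : ∀ z ∈ Metric.ball (0 : ℂ) 1, ∀ x, W (charFun J₁ J₁' z x) = charFun J₂ J₂' z (V x)) :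
    MomentsAgree J₁ J₁' J₂ J₂' V W := by
  intro n x
  -- These are the Taylor tails: `F n 0` is the `n`-th moment and `F n z = F n 0 + z F (n + 1) z`.
  -- Agreement passes from `n` to `n + 1` by dividing by `z ≠ 0`, and reaches `z = 0` by continuity.
  let F₁ : ℕ → ℂ → J₂.ker := fun n z =>
    W (J₁.ker.orthogonalProjectionOnto ((J₁ ^ n) (resolv J₁ z x)))
  let F₂ : ℕ → ℂ → J₂.ker := fun n z =>
    J₂.ker.orthogonalProjectionOnto ((J₂ ^ n) (resolv J₂ z (V x)))
  have h0 : (0 : ℂ) ∈ Metric.ball (0 : ℂ) 1 := by simp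
  have hball : Metric.ball (0 : ℂ) 1 ∈ nhds 0 := Metric.ball_mem_nhds _ one_pos
  have hr₁ : resolv J₁ 0 = 1 := by simp [resolv]
  have hr₂ : resolv J₂ 0 = 1 := by simp [resolv]
  have zero_of : ∀ n, (∀ z ∈ Metric.ball (0 : ℂ) 1, z ≠ 0 → F₁ n z = F₂ n z) →
      F₁ n 0 = F₂ n 0 := by
    intro n hn
    have c₁ : ContinuousAt (resolv J₁) 0 :=
      ((differentiableOn_resolv hJ₁).continuousOn).continuousAt hball
    have c₂ : ContinuousAt (resolv J₂) 0 :=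
      ((differentiableOn_resolv hJ₂).continuousOn).continuousAt hball
    have k₁ : ContinuousAt (F₁ n) 0 := by
      have := c₁.clm_apply (continuousAt_const (y := (x : H₁)))
      simp only [F₁]
      fun_prop
    have k₂ : ContinuousAt (F₂ n) 0 := by
      have := c₂.clm_apply (continuousAt_const (y := (V x : H₂)))
      simp only [F₂]
      fun_prop
    have : F₁ n =ᶠ[nhdsWithin 0 {0}ᶜ] F₂ n := by
      filter_upwards [self_mem_nhdsWithin, mem_nhdsWithin_of_mem_nhds hball] with z hz0 hz
      exact hn z hz hz0
    exact ((k₁.eventuallyEq_nhds_iff_eventuallyEq_nhdsNE k₂).1 this).self_of_nhds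
  have key : ∀ n, ∀ z ∈ Metric.ball (0 : ℂ) 1, z ≠ 0 → F₁ n z = F₂ n z := by
    intro n
    induction n with
    | zero =>
      intro z hz hz0
      have := h z hz x
      rw [charFun_apply, charFun_apply, map_smul] at this
      exact smul_right_injective _ hz0 this
    | succ n ih =>
      intro z hz hz0
      have e := ih z hz hz0
      have e0 := zero_of n ih
      simp only [F₁, F₂, hr₁, hr₂, one_apply_eq_self] at e0
      simp only [F₁, F₂] at e
      rw [proj_pow_resolv hJ₁ hz, proj_pow_resolv hJ₂ hz, map_add, e0, map_smul] at e
      exact smul_right_injective _ hz0 (add_left_cancel e)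
  have := zero_of n (key n)
  simpa only [F₁, F₂, hr₁, hr₂, one_apply_eq_self] using this

end CharFunMoments

/-! ### The isometric part of an operator -/

section IsoPart

variable {H : Type*} [NormedAddCommGroup H] [InnerProductSpace ℂ H] [CompleteSpace H]

instance (T : H →L[ℂ] H) : CompleteSpace (unitaryDomain T) :=
  (isClosed_unitaryDomain T).completeSpace_coe

theorem mem_unitaryDomain {T : H →L[ℂ] H} {x : H} :
    x ∈ unitaryDomain T ↔ ContinuousLinearMap.adjoint T (T x) = x := by
  change x - ContinuousLinearMap.adjoint T (T x) = 0 ↔ _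
  rw [sub_eq_zero, eq_comm]

/-- The adjoint `P_K T*` of the isometric part of `T`. -/
def isoPartAdj (T : H →L[ℂ] H) : H →L[ℂ] H :=
  (unitaryDomain T).starProjection ∘L ContinuousLinearMap.adjoint T

/-- The isometric part `T P_K` of `T`. -/
def isoPart (T : H →L[ℂ] H) : H →L[ℂ] H := T ∘L (unitaryDomain T).starProjection

variable (T : H →L[ℂ] H)

theorem isoPartAdj_apply (x : H) : isoPartAdj T x =
    (unitaryDomain T).starProjection (ContinuousLinearMap.adjoint T x) := rfl

theorem isoPart_apply (x : H) : isoPart T x = T ((unitaryDomain T).starProjection x) := rfl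

theorem isoPartAdj_isoPart (x : H) :
    isoPartAdj T (isoPart T x) = (unitaryDomain T).starProjection x := by
  rw [isoPartAdj_apply, isoPart_apply,
    mem_unitaryDomain.1 (Submodule.starProjection_apply_mem (unitaryDomain T) x)]
  exact Submodule.starProjection_eq_self_iff.2 (Submodule.starProjection_apply_mem _ x)

theorem isPartialIsometryPair_isoPart : IsPartialIsometryPair (isoPartAdj T) (isoPart T) where
  adj x y := by
    rw [isoPartAdj_apply, isoPart_apply, Submodule.inner_starProjection_left_eq_right,
      ContinuousLinearMap.adjoint_inner_left]
  left x := by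
    rw [isoPartAdj_isoPart]
    exact Submodule.starProjection_eq_self_iff.2 (Submodule.starProjection_apply_mem _ _)
  right x := by
    rw [isoPartAdj_isoPart, isoPart_apply, isoPart_apply,
      Submodule.starProjection_eq_self_iff.2 (Submodule.starProjection_apply_mem _ _)]

theorem ker_isoPart : (isoPart T).ker = (unitaryDomain T)ᗮ := by
  ext x
  rw [← Submodule.starProjection_apply_eq_zero_iff, LinearMap.mem_ker]
  constructor
  · intro h
    rw [← isoPartAdj_isoPart, show isoPart T x = 0 from h, map_zero]
  · intro h
    change isoPart T x = 0
    rw [isoPart_apply, h, map_zero]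

variable {T}

theorem norm_isoPartAdj_le (hT : ‖T‖ ≤ 1) : ‖isoPartAdj T‖ ≤ 1 := by
  refine (ContinuousLinearMap.opNorm_comp_le _ _).trans ?_
  rw [LinearIsometryEquiv.norm_map]
  exact mul_le_one₀ (Submodule.starProjection_norm_le _) (norm_nonneg _) hT

/-- Complete non-unitarity means that the orbits of the defect spaces span a dense subspace. -/
theorem IsCNU.dense_orbitVectors (hc : IsCNU T) :
    (Submodule.span ℂ (Set.range
      (orbitVectors (isoPartAdj T) (isoPart T)))).topologicalClosure = ⊤ := by
  set J := isoPartAdj T with hJdef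
  set J' := isoPart T with hJ'def
  have h : IsPartialIsometryPair J J' := isPartialIsometryPair_isoPart T
  rw [Submodule.topologicalClosure_eq_top_iff]
  set M := (Submodule.span ℂ (Set.range (orbitVectors J J')))ᗮ with hM
  have mem_iff : ∀ x, x ∈ M ↔ (∀ n (u : J'.ker), inner ℂ ((J ^ n) (u : H)) x = 0) ∧
      ∀ n (w : J.ker), inner ℂ ((J' ^ n) (w : H)) x = 0 := by
    intro x
    rw [hM, Submodule.mem_orthogonal]
    constructor
    · intro hx
      exact ⟨fun n u => hx _ (Submodule.subset_span ⟨Sum.inl (n, u), rfl⟩),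
        fun n w => hx _ (Submodule.subset_span ⟨Sum.inr (n, w), rfl⟩)⟩
    · rintro ⟨h1, h2⟩ v hv
      induction hv using Submodule.span_induction with
      | mem v hv =>
        obtain ⟨⟨n, u⟩ | ⟨n, w⟩, rfl⟩ := hv
        · exact h1 n u
        · exact h2 n w
      | zero => simp
      | add a b _ _ ha hb => rw [inner_add_left, ha, hb, add_zero]
      | smul c a _ ha => rw [inner_smul_left, ha, mul_zero]
  -- The orbit vectors with exponent `0` fill both defect spaces, so `M` is orthogonal to them and
  -- `J`, `J'` are mutually inverse there.
  have fix₁ : ∀ x ∈ M, J (J' x) = x := by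
    intro x hx
    have h0 : J'.ker.orthogonalProjectionOnto x = 0 := by
      refine ext_inner_left ℂ fun v => ?_
      rw [inner_proj_right, inner_zero_right]
      exact ((mem_iff x).1 hx).1 0 v
    have := h.symm.coe_proj x
    rw [h0] at this
    exact (sub_eq_zero.1 this.symm).symm
  have fix₂ : ∀ x ∈ M, J' (J x) = x := by
    intro x hx
    have h0 : J.ker.orthogonalProjectionOnto x = 0 := by
      refine ext_inner_left ℂ fun v => ?_
      rw [inner_proj_right, inner_zero_right]
      exact ((mem_iff x).1 hx).2 0 v
    have := h.coe_proj x
    rw [h0] at this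
    exact (sub_eq_zero.1 this.symm).symm
  -- Adjointness raises the exponent in one family and lowers it in the other by `fix₁`; exponent
  -- `0` in the latter gives zero because `J` kills `ker J`.
  have map₁ : ∀ x ∈ M, J' x ∈ M := by
    intro x hx
    refine (mem_iff _).2 ⟨fun n u => ?_, fun n w => ?_⟩
    · rw [← h.adj, ← mul_apply_eq_comp, ← pow_succ']
      exact ((mem_iff x).1 hx).1 _ u
    · cases n with
      | zero => rw [← h.adj, pow_zero, one_apply_eq_self, show J (w : H) = 0 from w.2,
          inner_zero_left]
      | succ n =>
        rw [pow_succ', mul_apply_eq_comp, h.symm.adj, fix₁ x hx]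
        exact ((mem_iff x).1 hx).2 n w
  have map₂ : ∀ x ∈ M, J x ∈ M := by
    intro x hx
    refine (mem_iff _).2 ⟨fun n u => ?_, fun n w => ?_⟩
    · cases n with
      | zero => rw [← h.symm.adj, pow_zero, one_apply_eq_self,
          show J' (u : H) = 0 from u.2, inner_zero_left]
      | succ n =>
        rw [pow_succ', mul_apply_eq_comp, h.adj, fix₂ x hx]
        exact ((mem_iff x).1 hx).1 n u
    · rw [← h.symm.adj, ← mul_apply_eq_comp, ← pow_succ']
      exact ((mem_iff x).1 hx).2 _ w
  -- On `M`, `x = J J' x = P_K x`, so `T` acts as its isometric part and is unitary on `M`; complete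
  -- non-unitarity forces `M = 0`.
  have T_eq : ∀ x ∈ M, T x = J' x := by
    intro x hx
    rw [hJ'def, isoPart_apply, ← isoPartAdj_isoPart, fix₁ x hx]
  refine hc M (Submodule.isClosed_orthogonal _) (le_antisymm ?_ ?_) ?_
  · rintro _ ⟨x, hx, rfl⟩
    change T x ∈ M
    rw [T_eq x hx]
    exact map₁ x hx
  · intro x hx
    refine ⟨J x, map₂ x hx, ?_⟩
    change T (J x) = x
    rw [T_eq _ (map₂ x hx), fix₂ x hx]
  · intro x hx
    have : inner ℂ (T x) (T x) = inner ℂ x x := by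
      rw [T_eq x hx, h.symm.adj, fix₁ x hx]
    rw [@norm_eq_sqrt_re_inner ℂ, this, ← @norm_eq_sqrt_re_inner ℂ]

end IsoPart

/-! ### The boundary space of a contraction -/

section Boundary

variable {H : Type*} [NormedAddCommGroup H] [InnerProductSpace ℂ H] [CompleteSpace H]
  {T : H →L[ℂ] H}

/-- Pairing `s` with `(k, T k)` gives `i(s₁ - T* s₂, k)`, so the condition is `P_K s₁ = P_K T* s₂`.
-/
theorem mem_symplOrth_unitaryGraph {s : WithLp 2 (H × H)} :
    s ∈ symplOrth (stdForm H) (unitaryGraph T) ↔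
      isoPartAdj T (isoPart T s.fst) = isoPartAdj T s.snd := by
  have hform : ∀ k, stdForm H s (graphMap T k) =
      I * inner ℂ k (s.fst - ContinuousLinearMap.adjoint T s.snd) := by
    intro k
    rw [stdForm_apply, inner_sub_right, ContinuousLinearMap.adjoint_inner_right]
    change I * inner ℂ k s.fst - I * inner ℂ (T k) s.snd = _
    ring
  rw [isoPartAdj_isoPart, isoPartAdj_apply, ← sub_eq_zero, ← map_sub,
    Submodule.starProjection_apply_eq_zero_iff, Submodule.mem_orthogonal]
  constructor
  · intro h k hk
    have := h (graphMap T k) ⟨k, hk, rfl⟩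
    rw [hform] at this
    exact (mul_eq_zero.1 this).resolve_left I_ne_zero
  · rintro h _ ⟨k, hk, rfl⟩
    change stdForm H s (graphMap T k) = 0
    rw [hform, h k hk, mul_zero]

theorem mem_unitaryGraph_iff {s : WithLp 2 (H × H)} :
    s ∈ unitaryGraph T ↔ s.fst ∈ unitaryDomain T ∧ s.snd = T s.fst := by
  constructor
  · rintro ⟨x, hx, rfl⟩
    exact ⟨hx, rfl⟩
  · rintro ⟨h1, h2⟩
    refine ⟨s.fst, h1, ?_⟩
    change WithLp.toLp 2 (s.fst, T s.fst) = s
    rw [← h2]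
    rfl

variable (T) in
/-- The projection of `A_T^⊥ˢ` onto the product of the two defect spaces. -/
def defectProj :
    symplOrth (stdForm H) (unitaryGraph T) →L[ℂ] (isoPart T).ker × (isoPartAdj T).ker :=
  ((isoPart T).ker.orthogonalProjectionOnto ∘L WithLp.fstL 2 ℂ H H ∘L
      (symplOrth (stdForm H) (unitaryGraph T)).subtypeL).prod
    ((isoPartAdj T).ker.orthogonalProjectionOnto ∘L WithLp.sndL 2 ℂ H H ∘L
      (symplOrth (stdForm H) (unitaryGraph T)).subtypeL)

theorem coe_defectProj_fst (s : symplOrth (stdForm H) (unitaryGraph T)) :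
    ((defectProj T s).1 : H) = (s : WithLp 2 (H × H)).fst -
      isoPartAdj T (isoPart T (s : WithLp 2 (H × H)).fst) :=
  (isPartialIsometryPair_isoPart T).symm.coe_proj _

theorem coe_defectProj_snd (s : symplOrth (stdForm H) (unitaryGraph T)) :
    ((defectProj T s).2 : H) = (s : WithLp 2 (H × H)).snd -
      isoPart T (isoPartAdj T (s : WithLp 2 (H × H)).snd) :=
  (isPartialIsometryPair_isoPart T).coe_proj _

theorem isoPartAdj_isoPart_eq_self {x : H} (hx : x ∈ unitaryDomain T) :
    isoPartAdj T (isoPart T x) = x := by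
  rw [isoPartAdj_isoPart]
  exact Submodule.starProjection_eq_self_iff.2 hx

theorem isoPart_eq_of_mem {x : H} (hx : x ∈ unitaryDomain T) : isoPart T x = T x := by
  rw [isoPart_apply, Submodule.starProjection_eq_self_iff.2 hx]

theorem unitaryGraph_le_ker_defectProj :
    (unitaryGraph T).submoduleOf (symplOrth (stdForm H) (unitaryGraph T)) ≤
      (defectProj T).ker := by
  intro s hs
  obtain ⟨h1, h2⟩ := mem_unitaryGraph_iff.1 (show (s : WithLp 2 (H × H)) ∈ _ from hs)
  refine Prod.ext (Subtype.ext ?_) (Subtype.ext ?_)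
  · change ((defectProj T s).1 : H) = 0
    rw [coe_defectProj_fst, isoPartAdj_isoPart_eq_self h1, sub_self]
  · change ((defectProj T s).2 : H) = 0
    rw [coe_defectProj_snd, h2, ← isoPart_eq_of_mem h1, isoPartAdj_isoPart_eq_self h1, sub_self]

theorem toLp_mem_symplOrth {x y : H} (hx : isoPart T x = 0) (hy : isoPartAdj T y = 0) :
    WithLp.toLp 2 (x, y) ∈ symplOrth (stdForm H) (unitaryGraph T) := by
  rw [mem_symplOrth_unitaryGraph]
  simp [hx, hy]

variable (T) in
/-- The inclusion of the product of the two defect spaces into `A_T^⊥ˢ`. -/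
def defectIncl :
    (isoPart T).ker × (isoPartAdj T).ker →L[ℂ] symplOrth (stdForm H) (unitaryGraph T) :=
  ((WithLp.prodContinuousLinearEquiv 2 ℂ H H).symm.toContinuousLinearMap ∘L
    ((isoPart T).ker.subtypeL.prodMap (isoPartAdj T).ker.subtypeL)).codRestrict _
    fun p => toLp_mem_symplOrth p.1.2 p.2.2

theorem coe_defectIncl (p : (isoPart T).ker × (isoPartAdj T).ker) :
    (defectIncl T p : WithLp 2 (H × H)) = WithLp.toLp 2 ((p.1 : H), (p.2 : H)) := rfl

theorem defectProj_defectIncl (p : (isoPart T).ker × (isoPartAdj T).ker) :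
    defectProj T (defectIncl T p) = p := by
  refine Prod.ext (Subtype.ext ?_) (Subtype.ext ?_)
  · rw [coe_defectProj_fst, coe_defectIncl]
    simp [show isoPart T (p.1 : H) = 0 from p.1.2]
  · rw [coe_defectProj_snd, coe_defectIncl]
    simp [show isoPartAdj T (p.2 : H) = 0 from p.2.2]

/-- Removing the defect components from `s` leaves `(J J' s₁, J' J s₂)`. Membership in `A_T^⊥ˢ` says
`J J' s₁ = J s₂`, which makes the second entry the image under `T` of the first. -/
theorem sub_defectIncl_mem (s : symplOrth (stdForm H) (unitaryGraph T)) :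
    defectIncl T (defectProj T s) - s ∈
      (unitaryGraph T).submoduleOf (symplOrth (stdForm H) (unitaryGraph T)) := by
  rw [← neg_mem_iff, neg_sub]
  change ((s - defectIncl T (defectProj T s) : symplOrth (stdForm H) (unitaryGraph T)) :
    WithLp 2 (H × H)) ∈ unitaryGraph T
  rw [mem_unitaryGraph_iff]
  have hs := mem_symplOrth_unitaryGraph.1 s.2
  have h1 : ((s - defectIncl T (defectProj T s) : symplOrth (stdForm H) (unitaryGraph T)) :
      WithLp 2 (H × H)).fst = isoPartAdj T (isoPart T (s : WithLp 2 (H × H)).fst) := by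
    change (s : WithLp 2 (H × H)).fst - ((defectProj T s).1 : H) = _
    rw [coe_defectProj_fst, sub_sub_cancel]
  have h2 : ((s - defectIncl T (defectProj T s) : symplOrth (stdForm H) (unitaryGraph T)) :
      WithLp 2 (H × H)).snd = isoPart T (isoPartAdj T (s : WithLp 2 (H × H)).snd) := by
    change (s : WithLp 2 (H × H)).snd - ((defectProj T s).2 : H) = _
    rw [coe_defectProj_snd, sub_sub_cancel]
  have h3 : isoPartAdj T (isoPart T (s : WithLp 2 (H × H)).fst) ∈ unitaryDomain T := by
    rw [isoPartAdj_isoPart]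
    exact Submodule.starProjection_apply_mem _ _
  rw [h1, h2]
  refine ⟨h3, ?_⟩
  rw [← isoPart_eq_of_mem h3, hs]

variable (T) in
/-- The boundary space is the sum of the defect spaces `K^⊥` and `(T K)^⊥`. -/
def boundaryEquiv : BoundarySpace T ≃L[ℂ] (isoPart T).ker × (isoPartAdj T).ker :=
  ContinuousLinearEquiv.equivOfInverse
    (Submodule.liftQL _ (defectProj T) unitaryGraph_le_ker_defectProj)
    (Submodule.mkQL _ ∘L defectIncl T)
    (by
      intro b
      obtain ⟨s, rfl⟩ := Submodule.Quotient.mk_surjective _ b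
      exact (Submodule.Quotient.eq _).2 (sub_defectIncl_mem s))
    defectProj_defectIncl

theorem boundaryEquiv_symm_apply (p : (isoPart T).ker × (isoPartAdj T).ker) :
    (boundaryEquiv T).symm p = Submodule.Quotient.mk (defectIncl T p) := rfl

variable (T) in
theorem isSplitting_boundaryEquiv : IsSplitting (markedDisc T).form (boundaryEquiv T) := by
  have key : ∀ p q, (markedDisc T).form ((boundaryEquiv T).symm p) ((boundaryEquiv T).symm q) =
      I * inner ℂ q.1 p.1 - I * inner ℂ q.2 p.2 := by
    intro p q
    rw [boundaryEquiv_symm_apply, boundaryEquiv_symm_apply]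
    exact quotForm_mk _ stdForm_skew _ _ _
  intro v w
  simpa using key (boundaryEquiv T v) (boundaryEquiv T w)

theorem mem_toQuot_iff {M : Submodule ℂ (WithLp 2 (H × H))} {b : BoundarySpace T} :
    b ∈ toQuot (stdForm H) (unitaryGraph T) M ↔
      ∃ s : symplOrth (stdForm H) (unitaryGraph T), (s : WithLp 2 (H × H)) ∈ M ∧
        defectProj T s = boundaryEquiv T b := by
  constructor
  · rintro ⟨s, hs, rfl⟩
    exact ⟨s, hs, rfl⟩
  · rintro ⟨s, hs, h⟩
    exact ⟨s, hs, (boundaryEquiv T).injective h⟩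

/-- A pair `(x, z x)` lies in `A_T^⊥ˢ` iff `J J' x = z J x`. Its first defect component is then `u =
(1 - z J) x`, so `x = (1 - z J)⁻¹ u`, and the second is `q (z x) = θ(z) u`. -/
theorem mem_curve_iff (hT : ‖T‖ ≤ 1) {z : ℂ} (hz : z ∈ Metric.ball (0 : ℂ) 1)
    (b : BoundarySpace T) : b ∈ (markedDisc T).curve z ↔
      (boundaryEquiv T b).2 = charFun (isoPartAdj T) (isoPart T) z (boundaryEquiv T b).1 := by
  have hJ := norm_isoPartAdj_le hT
  have hp := isPartialIsometryPair_isoPart T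
  change b ∈ toQuot _ _ _ ↔ _
  rw [mem_toQuot_iff]
  constructor
  · rintro ⟨s, ⟨x, -, hx⟩, hs⟩
    have hx1 : (s : WithLp 2 (H × H)).fst = x := by rw [← hx]; rfl
    have hx2 : (s : WithLp 2 (H × H)).snd = z • x := by rw [← hx]; rfl
    have hmem := mem_symplOrth_unitaryGraph.1 s.2
    rw [hx1, hx2, map_smul] at hmem
    rw [← hs]
    have hr : resolv (isoPartAdj T) z ((defectProj T s).1 : H) = x := by
      refine resolv_apply_eq hJ hz ?_
      rw [coe_defectProj_fst, hx1, hmem]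
    rw [charFun_apply, hr, ← map_smul, ← hx2]
    rfl
  · intro h
    set u := (boundaryEquiv T b).1 with hu
    set x := resolv (isoPartAdj T) z (u : H) with hx
    have hJx := hp.proj_resolv hJ hz u
    rw [← hx] at hJx
    have hs : graphMap (z • ContinuousLinearMap.id ℂ H) x ∈
        symplOrth (stdForm H) (unitaryGraph T) := by
      rw [mem_symplOrth_unitaryGraph]
      change isoPartAdj T (isoPart T x) = isoPartAdj T (z • x)
      rw [hJx, map_smul]
    refine ⟨⟨_, hs⟩, ⟨x, trivial, rfl⟩, Prod.ext (Subtype.ext ?_) ?_⟩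
    · rw [coe_defectProj_fst]
      change x - isoPartAdj T (isoPart T x) = u
      rw [hJx]
      exact resolv_sub hJ hz (u : H)
    · rw [h, charFun_apply, ← map_smul]
      rfl

/-- For `k ∈ K`, `(T* T x, k) = (x, T* T k) = (x, k) = 0`: thus `T` maps `K^⊥` into `(T K)^⊥`. -/
theorem isoPartAdj_apply_of_mem_ker {x : H} (hx : x ∈ (isoPart T).ker) :
    isoPartAdj T (T x) = 0 := by
  rw [ker_isoPart] at hx
  rw [isoPartAdj_apply, Submodule.starProjection_apply_eq_zero_iff, Submodule.mem_orthogonal]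
  intro k hk
  rw [ContinuousLinearMap.adjoint_inner_right, ← ContinuousLinearMap.adjoint_inner_left,
    mem_unitaryDomain.1 hk]
  exact (Submodule.mem_orthogonal _ _).1 hx k hk

variable (T) in
/-- The non-unitary part of `T` as a map between the defect spaces. -/
def nonUnitaryPart : (isoPart T).ker →L[ℂ] (isoPartAdj T).ker :=
  (T ∘L (isoPart T).ker.subtypeL).codRestrict _ fun x => isoPartAdj_apply_of_mem_ker x.2

theorem coe_nonUnitaryPart (x : (isoPart T).ker) : (nonUnitaryPart T x : H) = T x := rfl

theorem mem_mark_iff (b : BoundarySpace T) : b ∈ (markedDisc T).mark ↔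
    (boundaryEquiv T b).2 = nonUnitaryPart T (boundaryEquiv T b).1 := by
  change b ∈ toQuot _ _ _ ↔ _
  rw [mem_toQuot_iff]
  constructor
  · rintro ⟨s, ⟨x, hx, hxs⟩, hs⟩
    have hx1 : (s : WithLp 2 (H × H)).fst = x := by rw [← hxs]; rfl
    have hx2 : (s : WithLp 2 (H × H)).snd = T x := by rw [← hxs]; rfl
    have hxk : x ∈ (isoPart T).ker := by rw [ker_isoPart]; exact hx
    rw [← hs]
    refine Subtype.ext ?_
    rw [coe_nonUnitaryPart, coe_defectProj_fst, coe_defectProj_snd, hx1, hx2,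
      isoPartAdj_apply_of_mem_ker hxk, show isoPart T x = 0 from hxk]
    simp
  · intro h
    refine ⟨defectIncl T (boundaryEquiv T b), ⟨(boundaryEquiv T b).1, ?_, ?_⟩,
      defectProj_defectIncl _⟩
    · rw [← ker_isoPart]
      exact (boundaryEquiv T b).1.2
    · rw [coe_defectIncl, h]
      rfl

/-- Expand `‖T* T x - x‖² = ‖T* T x‖² - 2 ‖T x‖² + ‖x‖² ≤ 0`. -/
theorem mem_unitaryDomain_of_norm_eq (hT : ‖T‖ ≤ 1) {x : H} (hx : ‖T x‖ = ‖x‖) :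
    x ∈ unitaryDomain T := by
  rw [mem_unitaryDomain, ← sub_eq_zero, ← norm_eq_zero]
  have h1 : ‖ContinuousLinearMap.adjoint T (T x)‖ ≤ ‖x‖ := by
    rw [← hx]
    refine (ContinuousLinearMap.le_opNorm _ _).trans ?_
    rw [LinearIsometryEquiv.norm_map]
    exact mul_le_of_le_one_left (norm_nonneg _) hT
  have h2 := @norm_sub_sq ℂ H _ _ _ (ContinuousLinearMap.adjoint T (T x)) x
  rw [ContinuousLinearMap.adjoint_inner_left, inner_self_eq_norm_sq, hx] at h2
  have h3 : ‖ContinuousLinearMap.adjoint T (T x)‖ ^ 2 ≤ ‖x‖ ^ 2 :=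
    pow_le_pow_left₀ (norm_nonneg _) h1 2
  have h4 : ‖ContinuousLinearMap.adjoint T (T x) - x‖ ^ 2 ≤ 0 := by linarith
  exact pow_eq_zero_iff two_ne_zero |>.1 (le_antisymm h4 (sq_nonneg _))

theorem norm_nonUnitaryPart_lt (hT : ‖T‖ ≤ 1) {x : (isoPart T).ker} (hx : x ≠ 0) :
    ‖nonUnitaryPart T x‖ < ‖x‖ := by
  have hle : ‖T x‖ ≤ ‖(x : H)‖ :=
    (T.le_opNorm _).trans (mul_le_of_le_one_left (norm_nonneg _) hT)
  refine lt_of_le_of_ne hle fun heq => hx (Subtype.ext ?_)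
  have h1 := mem_unitaryDomain_of_norm_eq hT (show ‖T x‖ = ‖(x : H)‖ from heq)
  have h2 : (x : H) ∈ (unitaryDomain T)ᗮ := by rw [← ker_isoPart]; exact x.2
  exact inner_self_eq_zero.1 ((Submodule.mem_orthogonal _ _).1 h2 _ h1)

theorem isNevanlinna_markedDisc (hT : ‖T‖ ≤ 1) : (markedDisc T).IsNevanlinna where
  strong := (isSplitting_boundaryEquiv T).isStrongSymplectic
  mem z hz := by
    have hz1 : ‖z‖ < 1 := by simpa using hz
    exact (isSplitting_boundaryEquiv T).isMaxComplPosDef_of_graph _ (mem_curve_iff hT hz)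
      (c := 1 - ‖z‖ ^ 2) (by nlinarith [norm_nonneg z])
      ((isPartialIsometryPair_isoPart T).norm_charFun_sq (norm_isoPartAdj_le hT) hz)
  holomorphic := (isSplitting_boundaryEquiv T).isHolomorphicOnDisc_of_graph _
    (differentiableOn_charFun (norm_isoPartAdj_le hT)) fun _ hz => mem_curve_iff hT hz
  mark := (isSplitting_boundaryEquiv T).isMaxPosDef_of_graph _ mem_mark_iff
    fun _ => norm_nonUnitaryPart_lt hT

end Boundary

/-! ### Congruence and unitary equivalence -/

section Diagonal

variable {X₁ X₂ Y₁ Y₂ : Type*}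
  [NormedAddCommGroup X₁] [InnerProductSpace ℂ X₁] [NormedAddCommGroup X₂] [InnerProductSpace ℂ X₂]
  [NormedAddCommGroup Y₁] [InnerProductSpace ℂ Y₁] [NormedAddCommGroup Y₂] [InnerProductSpace ℂ Y₂]

/-- A linear isomorphism preserving the indefinite inner product and the positive summand is the
direct sum of two unitaries. -/
theorem exists_diagonal_of_indefinite_isometry (F : (X₁ × Y₁) ≃L[ℂ] (X₂ × Y₂))
    (hF : ∀ p q, (inner ℂ (F p).1 (F q).1 : ℂ) - inner ℂ (F p).2 (F q).2 =
      inner ℂ p.1 q.1 - inner ℂ p.2 q.2)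
    (h0 : ∀ p, (F p).2 = 0 ↔ p.2 = 0) :
    ∃ (V : X₁ ≃ₗᵢ[ℂ] X₂) (W : Y₁ ≃ₗᵢ[ℂ] Y₂), ∀ p, F p = (V p.1, W p.2) := by
  have fa : ∀ x, (F (x, 0)).2 = 0 := fun x => (h0 _).2 rfl
  have fb : ∀ x, (F.symm (x, 0)).2 = 0 := fun x => (h0 _).1 (by simp)
  -- `0 ⊕ Y` is orthogonal to `X ⊕ 0` for the indefinite product, and `F` maps `X₁ ⊕ 0` onto `X₂ ⊕
  -- 0`.
  have fc : ∀ y, (F (0, y)).1 = 0 := by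
    intro y
    refine ext_inner_right ℂ fun x => ?_
    have := hF (0, y) (F.symm (x, 0))
    simpa [fb] using this
  have fd : ∀ y, (F.symm (0, y)).1 = 0 := by
    intro y
    refine ext_inner_right ℂ fun x => ?_
    have := hF (F.symm (0, y)) (x, 0)
    simpa [fa] using this.symm
  have ea : ∀ x, F (x, 0) = ((F (x, 0)).1, 0) := fun x => Prod.ext rfl (fa x)
  have eb : ∀ x, F.symm (x, 0) = ((F.symm (x, 0)).1, 0) := fun x => Prod.ext rfl (fb x)
  have ec : ∀ y, F (0, y) = (0, (F (0, y)).2) := fun y => Prod.ext (fc y) rfl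
  have ed : ∀ y, F.symm (0, y) = (0, (F.symm (0, y)).2) := fun y => Prod.ext (fd y) rfl
  let V₀ : X₁ ≃ₗ[ℂ] X₂ := LinearEquiv.ofLinearMap
    (LinearMap.fst ℂ X₂ Y₂ ∘ₗ F.toLinearEquiv.toLinearMap ∘ₗ LinearMap.inl ℂ X₁ Y₁)
    (LinearMap.fst ℂ X₁ Y₁ ∘ₗ F.symm.toLinearEquiv.toLinearMap ∘ₗ LinearMap.inl ℂ X₂ Y₂)
    (LinearMap.ext fun x => by
      change (F ((F.symm (x, 0)).1, 0)).1 = x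
      rw [← eb, F.apply_symm_apply])
    (LinearMap.ext fun x => by
      change (F.symm ((F (x, 0)).1, 0)).1 = x
      rw [← ea, F.symm_apply_apply])
  let W₀ : Y₁ ≃ₗ[ℂ] Y₂ := LinearEquiv.ofLinearMap
    (LinearMap.snd ℂ X₂ Y₂ ∘ₗ F.toLinearEquiv.toLinearMap ∘ₗ LinearMap.inr ℂ X₁ Y₁)
    (LinearMap.snd ℂ X₁ Y₁ ∘ₗ F.symm.toLinearEquiv.toLinearMap ∘ₗ LinearMap.inr ℂ X₂ Y₂)
    (LinearMap.ext fun y => by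
      change (F (0, (F.symm (0, y)).2)).2 = y
      rw [← ed, F.apply_symm_apply])
    (LinearMap.ext fun y => by
      change (F.symm (0, (F (0, y)).2)).2 = y
      rw [← ec, F.symm_apply_apply])
  have hV : ∀ x, V₀ x = (F (x, 0)).1 := fun x => rfl
  have hW : ∀ y, W₀ y = (F (0, y)).2 := fun y => rfl
  refine ⟨⟨V₀, fun x => ?_⟩, ⟨W₀, fun y => ?_⟩, fun p => ?_⟩
  · have := hF (x, 0) (x, 0)
    rw [fa, inner_zero_left, inner_zero_left, sub_zero, sub_zero, ← hV] at this
    rw [@norm_eq_sqrt_re_inner ℂ, this, ← @norm_eq_sqrt_re_inner ℂ]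
  · have := hF (0, y) (0, y)
    rw [fc, inner_zero_left, inner_zero_left, zero_sub, zero_sub, ← hW] at this
    rw [@norm_eq_sqrt_re_inner ℂ, neg_injective this, ← @norm_eq_sqrt_re_inner ℂ]
  · change F p = (V₀ p.1, W₀ p.2)
    have : p = (p.1, 0) + (0, p.2) := by simp
    nth_rewrite 1 [this]
    rw [map_add, ea, ec, hV, hW]
    simp

end Diagonal

section Transport

variable {H₁ H₂ : Type*} [NormedAddCommGroup H₁] [InnerProductSpace ℂ H₁]
  [NormedAddCommGroup H₂] [InnerProductSpace ℂ H₂]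

/-- A unitary intertwining two operators restricts to their kernels. -/
def kerEquiv (U : H₁ ≃ₗᵢ[ℂ] H₂) {A : H₁ →L[ℂ] H₁} {B : H₂ →L[ℂ] H₂}
    (hU : ∀ x, U (A x) = B (U x)) : A.ker ≃L[ℂ] B.ker :=
  U.toContinuousLinearEquiv.ofSubmodules A.ker B.ker (by
    ext y
    obtain ⟨x, rfl⟩ := U.surjective y
    constructor
    · rintro ⟨x', hx', h⟩
      obtain rfl : x' = x := U.injective h
      change B (U x') = 0
      rw [← hU, show A x' = 0 from hx', map_zero]
    · intro h
      refine ⟨x, ?_, rfl⟩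
      have h' : B (U x) = 0 := h
      rw [← hU] at h'
      exact U.map_eq_zero_iff.1 h')

theorem coe_kerEquiv (U : H₁ ≃ₗᵢ[ℂ] H₂) {A : H₁ →L[ℂ] H₁} {B : H₂ →L[ℂ] H₂}
    (hU : ∀ x, U (A x) = B (U x)) (x : A.ker) : (kerEquiv U hU x : H₂) = U x := rfl

theorem map_eq_of_mem_iff {E F : Type*} [NormedAddCommGroup E] [InnerProductSpace ℂ E]
    [NormedAddCommGroup F] [InnerProductSpace ℂ F] (Φ : E ≃L[ℂ] F) {L : Submodule ℂ E}
    {M : Submodule ℂ F} (h : ∀ b, b ∈ L ↔ Φ b ∈ M) : L.map (Φ : E →ₗ[ℂ] F) = M := by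
  ext c
  constructor
  · rintro ⟨b, hb, rfl⟩
    exact (h b).1 hb
  · intro hc
    refine ⟨Φ.symm c, (h _).2 (by simpa using hc), ?_⟩
    exact Φ.apply_symm_apply c

theorem mem_iff_of_map_eq {E F : Type*} [NormedAddCommGroup E] [InnerProductSpace ℂ E]
    [NormedAddCommGroup F] [InnerProductSpace ℂ F] (Φ : E ≃L[ℂ] F) {L : Submodule ℂ E}
    {M : Submodule ℂ F} (h : L.map (Φ : E →ₗ[ℂ] F) = M) (b : E) : b ∈ L ↔ Φ b ∈ M := by
  rw [← h]
  constructor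
  · exact fun hb => ⟨b, hb, rfl⟩
  · rintro ⟨b', hb', h'⟩
    exact Φ.injective h' ▸ hb'

end Transport

/-! ### The two directions of the equivalence -/

section Equivalence

theorem apply_eq_isoPart_add {H : Type*} [NormedAddCommGroup H] [InnerProductSpace ℂ H]
    [CompleteSpace H] (T : H →L[ℂ] H) (x : H) :
    T x = isoPart T x + T (x - isoPartAdj T (isoPart T x)) := by
  rw [isoPartAdj_isoPart, isoPart_apply, map_sub, add_sub_cancel]

variable {H₁ H₂ : Type*}
  [NormedAddCommGroup H₁] [InnerProductSpace ℂ H₁] [CompleteSpace H₁]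
  [NormedAddCommGroup H₂] [InnerProductSpace ℂ H₂] [CompleteSpace H₂]
  {T₁ : H₁ →L[ℂ] H₁} {T₂ : H₂ →L[ℂ] H₂}

theorem intertwine_adjoint (U : H₁ ≃ₗᵢ[ℂ] H₂) {A : H₁ →L[ℂ] H₁} {B : H₂ →L[ℂ] H₂}
    (hU : ∀ x, U (A x) = B (U x)) (x : H₁) :
    U (ContinuousLinearMap.adjoint A x) = ContinuousLinearMap.adjoint B (U x) := by
  refine ext_inner_right ℂ fun y => ?_
  obtain ⟨y, rfl⟩ := U.surjective y
  rw [U.inner_map_map, ContinuousLinearMap.adjoint_inner_left,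
    ContinuousLinearMap.adjoint_inner_left, ← hU, U.inner_map_map]

theorem map_mem_unitaryDomain_iff (U : H₁ ≃ₗᵢ[ℂ] H₂) (hU : ∀ x, U (T₁ x) = T₂ (U x)) {x : H₁} :
    U x ∈ unitaryDomain T₂ ↔ x ∈ unitaryDomain T₁ := by
  rw [mem_unitaryDomain, mem_unitaryDomain, ← hU, ← intertwine_adjoint U hU, U.injective.eq_iff]

theorem intertwine_starProjection (U : H₁ ≃ₗᵢ[ℂ] H₂) (hU : ∀ x, U (T₁ x) = T₂ (U x)) (x : H₁) :
    U ((unitaryDomain T₁).starProjection x) = (unitaryDomain T₂).starProjection (U x) := by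
  symm
  refine Submodule.eq_starProjection_of_mem_orthogonal
    ((map_mem_unitaryDomain_iff U hU).2 (Submodule.starProjection_apply_mem _ _)) ?_
  rw [Submodule.mem_orthogonal]
  intro k hk
  obtain ⟨k, rfl⟩ := U.surjective k
  rw [← map_sub, U.inner_map_map]
  exact (Submodule.mem_orthogonal _ _).1 (Submodule.sub_starProjection_mem_orthogonal x) k
    ((map_mem_unitaryDomain_iff U hU).1 hk)

theorem intertwine_isoPart (U : H₁ ≃ₗᵢ[ℂ] H₂) (hU : ∀ x, U (T₁ x) = T₂ (U x)) (x : H₁) :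
    U (isoPart T₁ x) = isoPart T₂ (U x) := by
  rw [isoPart_apply, isoPart_apply, hU, intertwine_starProjection U hU]

theorem intertwine_isoPartAdj (U : H₁ ≃ₗᵢ[ℂ] H₂) (hU : ∀ x, U (T₁ x) = T₂ (U x)) (x : H₁) :
    U (isoPartAdj T₁ x) = isoPartAdj T₂ (U x) := by
  rw [isoPartAdj_apply, isoPartAdj_apply, intertwine_starProjection U hU, intertwine_adjoint U hU]

/-- The unitary carries `K`, `J` and `J'` along, so its restrictions to the defect spaces add up to
a symplectic isomorphism matching the graphs. -/
theorem congruent_of_unitarilyEquivalent (hT₁ : ‖T₁‖ ≤ 1) (hT₂ : ‖T₂‖ ≤ 1)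
    (h : UnitarilyEquivalent T₁ T₂) : (markedDisc T₁).Congruent (markedDisc T₂) := by
  obtain ⟨U, hU⟩ := h
  have hJ := intertwine_isoPartAdj U hU
  have hJ' := intertwine_isoPart U hU
  let V := kerEquiv U hJ'
  let W := kerEquiv U hJ
  let Φ : BoundarySpace T₁ ≃L[ℂ] BoundarySpace T₂ :=
    (boundaryEquiv T₁).trans ((V.prodCongr W).trans (boundaryEquiv T₂).symm)
  have hΦ : ∀ b, boundaryEquiv T₂ (Φ b) = (V (boundaryEquiv T₁ b).1, W (boundaryEquiv T₁ b).2) := by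
    intro b
    change boundaryEquiv T₂ ((boundaryEquiv T₂).symm _) = _
    rw [ContinuousLinearEquiv.apply_symm_apply]
    rfl
  refine ⟨Φ, fun x y => ?_, fun z hz => ?_, ?_⟩
  · rw [isSplitting_boundaryEquiv T₂, isSplitting_boundaryEquiv T₁, hΦ, hΦ]
    simp only [Submodule.coe_inner, V, W, coe_kerEquiv, U.inner_map_map]
  · refine map_eq_of_mem_iff (E := BoundarySpace T₁) (F := BoundarySpace T₂) Φ fun b => ?_
    rw [mem_curve_iff hT₁ hz, mem_curve_iff hT₂ hz, hΦ]
    have hchar : ∀ x, charFun (isoPartAdj T₂) (isoPart T₂) z (V x) =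
        W (charFun (isoPartAdj T₁) (isoPart T₁) z x) := by
      intro x
      have hr : resolv (isoPartAdj T₂) z (V x) = U (resolv (isoPartAdj T₁) z x) := by
        refine resolv_apply_eq (norm_isoPartAdj_le hT₂) hz ?_
        rw [← hJ, ← map_smul, ← map_sub, resolv_sub (norm_isoPartAdj_le hT₁) hz]
        rfl
      refine Subtype.ext ?_
      rw [coe_kerEquiv, charFun_apply, charFun_apply, hr, Submodule.coe_smul, Submodule.coe_smul,
        (isPartialIsometryPair_isoPart T₁).coe_proj, (isPartialIsometryPair_isoPart T₂).coe_proj,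
        map_smul, map_sub, hJ', hJ]
    rw [hchar, W.injective.eq_iff]
  · refine map_eq_of_mem_iff (E := BoundarySpace T₁) (F := BoundarySpace T₂) Φ fun b => ?_
    rw [mem_mark_iff, mem_mark_iff, hΦ]
    have hn : ∀ x, nonUnitaryPart T₂ (V x) = W (nonUnitaryPart T₁ x) := fun x =>
      Subtype.ext (hU x).symm
    rw [hn, W.injective.eq_iff]

theorem unitarilyEquivalent_of_congruent (hT₁ : ‖T₁‖ ≤ 1) (hT₂ : ‖T₂‖ ≤ 1)
    (hc₁ : IsCNU T₁) (hc₂ : IsCNU T₂)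
    (h : (markedDisc T₁).Congruent (markedDisc T₂)) : UnitarilyEquivalent T₁ T₂ := by
  obtain ⟨Φ, hform, hcurve, hmark⟩ := h
  let F : ((isoPart T₁).ker × (isoPartAdj T₁).ker) ≃L[ℂ] ((isoPart T₂).ker × (isoPartAdj T₂).ker) :=
    (boundaryEquiv T₁).symm.trans (Φ.trans (boundaryEquiv T₂))
  have hFΦ : ∀ p, F p = boundaryEquiv T₂ (Φ ((boundaryEquiv T₁).symm p)) := fun p => rfl
  have hF : ∀ p q, (inner ℂ (F p).1 (F q).1 : ℂ) - inner ℂ (F p).2 (F q).2 =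
      inner ℂ p.1 q.1 - inner ℂ p.2 q.2 := by
    intro p q
    have := hform ((boundaryEquiv T₁).symm q) ((boundaryEquiv T₁).symm p)
    rw [isSplitting_boundaryEquiv T₂, isSplitting_boundaryEquiv T₁, ← hFΦ, ← hFΦ,
      ContinuousLinearEquiv.apply_symm_apply, ContinuousLinearEquiv.apply_symm_apply,
      ← mul_sub, ← mul_sub] at this
    exact mul_left_cancel₀ I_ne_zero this
  have hchar : ∀ z ∈ Metric.ball (0 : ℂ) 1, ∀ p,
      p.2 = charFun (isoPartAdj T₁) (isoPart T₁) z p.1 ↔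
        (F p).2 = charFun (isoPartAdj T₂) (isoPart T₂) z (F p).1 := by
    intro z hz p
    have := mem_iff_of_map_eq Φ (hcurve z hz) ((boundaryEquiv T₁).symm p)
    rwa [mem_curve_iff hT₁ hz, mem_curve_iff hT₂ hz, ← hFΦ,
      ContinuousLinearEquiv.apply_symm_apply] at this
  -- The characteristic function vanishes at `z = 0`, so the curve passes through the positive
  -- summand there.
  have h0 : ∀ p, (F p).2 = 0 ↔ p.2 = 0 := by
    intro p
    have := hchar 0 (by simp) p
    rw [charFun_apply, charFun_apply, zero_smul, zero_smul] at this
    exact this.symm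
  obtain ⟨V, W, hVW⟩ := exists_diagonal_of_indefinite_isometry F hF h0
  have hm : MomentsAgree (isoPartAdj T₁) (isoPart T₁) (isoPartAdj T₂) (isoPart T₂) V W := by
    refine momentsAgree_of_charFun (norm_isoPartAdj_le hT₁) (norm_isoPartAdj_le hT₂) ?_
    intro z hz x
    have := (hchar z hz (x, charFun (isoPartAdj T₁) (isoPart T₁) z x)).1 rfl
    rwa [hVW] at this
  have hp₁ := isPartialIsometryPair_isoPart T₁
  have hp₂ := isPartialIsometryPair_isoPart T₂
  obtain ⟨U, hUV, hUW, hUJ⟩ := hm.exists_unitary hp₁ hp₂ hc₁.dense_orbitVectors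
    hc₂.dense_orbitVectors
  have hUJ' : ∀ x, U (isoPart T₁ x) = isoPart T₂ (U x) := by
    intro x
    refine ext_inner_left ℂ fun y => ?_
    obtain ⟨y, rfl⟩ := U.surjective y
    rw [U.inner_map_map, ← hp₁.adj, ← hp₂.adj, ← hUJ, U.inner_map_map]
  -- The moments fix `U` on the isometric parts only; the marked subspaces supply the intertwining
  -- on `K^⊥`.
  have hN : ∀ x, U (nonUnitaryPart T₁ x) = T₂ (U x) := by
    intro x
    have := mem_iff_of_map_eq Φ hmark ((boundaryEquiv T₁).symm (x, nonUnitaryPart T₁ x))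
    rw [mem_mark_iff, mem_mark_iff, ← hFΦ, ContinuousLinearEquiv.apply_symm_apply, hVW] at this
    have hW : W (nonUnitaryPart T₁ x) = nonUnitaryPart T₂ (V x) := this.1 rfl
    rw [hUW, hW, hUV]
    rfl
  refine ⟨U, fun x => ?_⟩
  have hx := hp₁.symm.coe_proj x
  have hN' := hN ((isoPart T₁).ker.orthogonalProjectionOnto x)
  rw [coe_nonUnitaryPart, hx] at hN'
  rw [apply_eq_isoPart_add T₁ x, map_add, hN', map_sub, hUJ, hUJ', ← apply_eq_isoPart_add T₂ (U x)]

end Equivalence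

end NevanlinnaDisc

end

theorem mainTheorem8 {H₁ H₂ : Type*}
    [NormedAddCommGroup H₁] [InnerProductSpace ℂ H₁] [CompleteSpace H₁]
    [NormedAddCommGroup H₂] [InnerProductSpace ℂ H₂] [CompleteSpace H₂]
    (T₁ : H₁ →L[ℂ] H₁) (T₂ : H₂ →L[ℂ] H₂)
    (hT₁ : ‖T₁‖ ≤ 1) (hT₂ : ‖T₂‖ ≤ 1)
    (hc₁ : NevanlinnaDisc.IsCNU T₁) (hc₂ : NevanlinnaDisc.IsCNU T₂) :
    (NevanlinnaDisc.markedDisc T₁).IsNevanlinna ∧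
    (NevanlinnaDisc.markedDisc T₂).IsNevanlinna ∧
    (NevanlinnaDisc.UnitarilyEquivalent T₁ T₂ ↔
      (NevanlinnaDisc.markedDisc T₁).Congruent (NevanlinnaDisc.markedDisc T₂)) :=
  ⟨NevanlinnaDisc.isNevanlinna_markedDisc hT₁, NevanlinnaDisc.isNevanlinna_markedDisc hT₂,
    NevanlinnaDisc.congruent_of_unitarilyEquivalent hT₁ hT₂,
    NevanlinnaDisc.unitarilyEquivalent_of_congruent hT₁ hT₂ hc₁ hc₂⟩
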